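/- There are universal constants $c_1,c_2,c_3>0$ and $k\in\mathbb N$ such that the following holds for every finite universe $\mathcal U$ (of arbitrary size), every $T\ge 1$, every $\varepsilon>0$, every $\eta\in(0,1/2)$ and every $\xi\in(0,1/2)$. There is a randomized one-pass streaming algorithm in the continual release model (it reads $a_1,\dots,a_T\in\mathcal U\cup\{\perp\}$ one by one and releases a real number $y_t$ after reading $a_t$) with these three properties. 1. (Privacy) The algorithm is $\varepsilon$-differentially private: for any two streams $\mathcal S,\mathcal S'$ of length $T$ that differ in at most one timestamp, and any set $O$ of output histories, $\Pr[(y_1,\dots,y_T)(\mathcal S)\in O]\le e^{\varepsilon}\cdot\Pr[(y_1,\dots,y_T)(\mathcal S')\in O]$. 2. (Accuracy) For every stream $(a_1,\dots,a_T)$, with probability at least $1-\xi$, simultaneously for all $t\in\{1,\dots,T\}$ the output $y_t$ is a $\left(1+c_1\eta,\;c_2\,\frac{\log^2(T/\xi)}{\eta^2\varepsilon}\right)$-approximation to the number $\|(a_1,\dots,a_t)\|_0$ of distinct elements of $\mathcal U$ among $a_1,\dots,a_t$. Here $y$ is an $(\alpha,\gamma)$-approximation to $x$ if $\frac1\alpha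 x-\gamma\le y\le\alpha x+\gamma$. 3. (Space) The algorithm uses at most $c_3\left(\frac{\log(T/\xi)}{\eta\min(\varepsilon,1)}\right)^{k}$ words of memory, where a word has $\lceil\log_2(|\mathcal U|+T+1)\rceil$ bits. Space is the memory carried from one timestamp to the next: on each input, the new memory and the output are drawn from a distribution that depends only on the current memory and that input. -/

import Mathlib

namespace ContinualRelease

noncomputable section

/-- A stream with `T` timestamps over the universe `U`; `none` is the empty input `⊥`. -/
abbrev Stream (U : Type*) (T : ℕ) : Type _ := Fin T → Option U

/-- The frequency of `u` among the inputs received up to and including timestamp `t`. -/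
def frequency {U : Type*} {T : ℕ} (S : Stream U T) (t : Fin T) (u : U) : ℕ :=
  {i : Fin T | i ≤ t ∧ S i = some u}.ncard

/-- The number of distinct (non-empty) elements received up to and including timestamp `t`. -/
def distinctCount {U : Type*} [Fintype U] {T : ℕ} (S : Stream U T) (t : Fin T) : ℕ :=
  ∑ u : U, if 0 < frequency S t u then 1 else 0

/-- `y` is an `(α, γ)`-approximation to `x`. -/
def IsApprox (α γ x y : ℝ) : Prop :=
  (1 / α) * x - γ ≤ y ∧ y ≤ α * x + γ

/-- Two streams are neighboring if they differ in at most one timestamp. -/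
def Neighboring {U : Type*} {T : ℕ} (S S' : Stream U T) : Prop :=
  ∃ t : Fin T, ∀ i : Fin T, i ≠ t → S i = S' i

/-- The number of bits in a machine word: the least `b` with `2 ^ b ≥ |U| + T + 1`, so that a word
can hold any element of `U ∪ {⊥}` and any time in `{0, …, T}`. -/
def wordSize (U : Type*) [Fintype U] (T : ℕ) : ℕ :=
  Nat.clog 2 (Fintype.card U + T + 1)

/-- The contents of a memory of `W` words of `b` bits each. -/
abbrev Memory (b W : ℕ) : Type := Fin W → Fin b → Bool

/-- A randomized one-pass streaming algorithm in the continual release model that uses `W` words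
of `b` bits. The memory is initialized at random before the stream starts. On each input the
algorithm sees only its memory and that input; with fresh randomness it rewrites its memory and
releases a real number. Whatever survives from one timestamp to the next (hash seeds, noise that is
used again, counters, the current time) has to be stored in the memory. -/
structure StreamingAlgorithm (U : Type*) (b W : ℕ) where
  /-- The law of the initial memory. -/
  init : PMF (Memory b W)
  /-- The joint law of the next memory and of the released output. -/
  step : Memory b W → Option U → PMF (Memory b W × ℝ)

namespace StreamingAlgorithm

variable {U : Type*} {b W : ℕ}

/-- The law of the sequence of outputs released on a stream, started from the memory `s`. -/
def runFrom (A : StreamingAlgorithm U b W) :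
    (T : ℕ) → Memory b W → Stream U T → PMF (Fin T → ℝ)
  | 0, _, _ => PMF.pure Fin.elim0
  | T + 1, s, S =>
      (A.step s (S 0)).bind fun p =>
        (runFrom A T p.1 (Fin.tail S)).map fun y => (Fin.cons p.2 y : Fin (T + 1) → ℝ)

/-- The law of the entire output history of the algorithm on the stream `S`. -/
def run (A : StreamingAlgorithm U b W) {T : ℕ} (S : Stream U T) : PMF (Fin T → ℝ) :=
  A.init.bind fun s => A.runFrom T s S

/-- The probability that the entire output history on the stream `S` lies in `O`. -/
def outputProb (A : StreamingAlgorithm U b W) {T : ℕ} (S : Stream U T)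
    (O : Set (Fin T → ℝ)) : ENNReal :=
  (A.run S).toOuterMeasure O

/-- Pure `ε`-differential privacy, on streams of length `T`, of the entire output history. -/
def IsDP (A : StreamingAlgorithm U b W) (T : ℕ) (ε : ℝ) : Prop :=
  ∀ S S' : Stream U T, Neighboring S S' → ∀ O : Set (Fin T → ℝ),
    A.outputProb S O ≤ ENNReal.ofReal (Real.exp ε) * A.outputProb S' O

end StreamingAlgorithm

end

end ContinualRelease

/-! Elements receive independent levels from a hash function, level `i ≠ 0` with probability `2 ^
(-i)`, while level `0` samples everything. Each level stores its sampled elements up to a capacity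
`C`. The released value is read off noisy stored counts: the first level that looks at most half
full is scaled up by `2 ^ i`. If `i ≠ 0`, level `i - 1` looked more than half full, so the expected
count at `i` is of order `C` and both sampling error and noise are relatively small
(`abs_estimate_sub_le`).

Privacy is a change of variables in the noise. At time `n` the noise of a level is a sum over `j` of
cells drawn at `n` rounded down to a multiple of `2 ^ j`. A change `G` of the counts is undone by
translating each cell by an increment of `G` between consecutive roundings; these telescope
(`sum_noiseAt_add_noiseShift`). Erasing one input changes a capped count by a difference of two
monotone `0/1` functions and affects only two levels, so the total translation is at most `4 * L`
(`sum_abs_noiseShift_le`). Two neighbors are compared through their common erased stream, which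
costs `8 * L`. The noise lives on `ZMod M`: translation is a bijection, states are finite, and for
`M` large the noise rarely wraps around.

A random hash function is too large to store. By the probabilistic method a fixed table of hash
functions serves every stream on all but a fraction `ξ / 2` of its rows (`exists_table`). The table
is part of the algorithm, and only the row index occupies memory. Privacy holds for each row
separately, so it does not depend on the quality of the table. -/

namespace ContinualRelease

noncomputable section

open Finset

/-! ### Transducers driven by independent randomness -/

/-- The outputs of a deterministic transducer `δ` fed with the stream `S` and the randomness `ω`. -/
def transduce {U σ Ω : Type*} (δ : σ → Option U → Ω → σ × ℝ) :
    (T : ℕ) → σ → Stream U T → (Fin T → Ω) → (Fin T → ℝ)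
  | 0, _, _, _ => Fin.elim0
  | T + 1, s, S, ω =>
      Fin.cons (δ s (S 0) (ω 0)).2
        (transduce δ T (δ s (S 0) (ω 0)).1 (Fin.tail S) (Fin.tail ω))

/-- The state of the transducer `δ` after `n` inputs. -/
def stateAt {U σ Ω : Type*} {T : ℕ} (δ : σ → Option U → Ω → σ × ℝ) (s : σ) (S : Stream U T)
    (ω : Fin T → Ω) : ℕ → σ
  | 0 => s
  | n + 1 =>
      if h : n < T then (δ (stateAt δ s S ω n) (S ⟨n, h⟩) (ω ⟨n, h⟩)).1 else stateAt δ s S ω n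

section Transducer

variable {U σ Ω ρ : Type*}

/-- `stateAt` recurses at the end of the stream and `transduce` at its front; this identity
reconciles the two. -/
theorem stateAt_tail {T : ℕ} (δ : σ → Option U → Ω → σ × ℝ) (s : σ) (S : Stream U (T + 1))
    (ω : Fin (T + 1) → Ω) (n : ℕ) :
    stateAt δ s S ω (n + 1) =
      stateAt δ (δ s (S 0) (ω 0)).1 (Fin.tail S) (Fin.tail ω) n := by
  induction n with
  | zero => simp [stateAt]
  | succ n ih =>
    rw [stateAt, ih]
    by_cases h : n < T
    · rw [dif_pos (by omega), stateAt, dif_pos h]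
      rfl
    · rw [dif_neg (by omega), stateAt, dif_neg h]

theorem transduce_apply {T : ℕ} (δ : σ → Option U → Ω → σ × ℝ) (s : σ) (S : Stream U T)
    (ω : Fin T → Ω) (t : Fin T) :
    transduce δ T s S ω t = (δ (stateAt δ s S ω t) (S t) (ω t)).2 := by
  induction T generalizing s with
  | zero => exact t.elim0
  | succ T ih =>
    refine Fin.cases ?_ (fun t => ?_) t
    · simp [transduce, stateAt]
    · rw [transduce, Fin.cons_succ, ih, Fin.val_succ, stateAt_tail]
      rfl

/-- The streaming algorithm that runs the transducer `δ` with fresh randomness of law `μ`. -/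
def ofTransducer {b W : ℕ} (enc : σ → Memory b W) (dec : Memory b W → σ) (ι : PMF ρ) (s₀ : ρ → σ) (μ : PMF Ω)
    (δ : σ → Option U → Ω → σ × ℝ) : StreamingAlgorithm U b W where
  init := ι.map fun r => enc (s₀ r)
  step m a := μ.map fun w => (enc (δ (dec m) a w).1, (δ (dec m) a w).2)

/-- Since each step draws fresh randomness, the output law is the image of a product law on `Fin T →
Ω`. Privacy and accuracy thereby become statements about finite sums over noise arrays. -/
theorem toOuterMeasure_runFrom_ofTransducer [Fintype Ω] {b W : ℕ} (enc : σ → Memory b W)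
    (dec : Memory b W → σ) (hdec : ∀ s, dec (enc s) = s) (ι : PMF ρ) (s₀ : ρ → σ)
    (μ : PMF Ω) (δ : σ → Option U → Ω → σ × ℝ) (T : ℕ) (s : σ) (S : Stream U T) (O : Set (Fin T → ℝ)) :
    ((ofTransducer enc dec ι s₀ μ δ).runFrom T (enc s) S).toOuterMeasure O =
      ∑ ω : Fin T → Ω, (∏ t, μ (ω t)) * O.indicator 1 (transduce δ T s S ω) := by
  induction T generalizing s with
  | zero =>
    rcases O.eq_empty_or_nonempty with rfl | h
    · simp
    · simp [StreamingAlgorithm.runFrom, Subsingleton.eq_univ_of_nonempty h,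
        (PMF.toOuterMeasure_apply_eq_one_iff _ _).2 (Set.subset_univ _)]
  | succ T ih =>
    rw [← (Fin.consEquiv fun _ => Ω).sum_comp, Fintype.sum_prod_type,
      StreamingAlgorithm.runFrom, ofTransducer, PMF.bind_map, PMF.toOuterMeasure_bind_apply,
      tsum_fintype]
    refine Finset.sum_congr rfl fun w _ => ?_
    simp only [Function.comp_apply, PMF.toOuterMeasure_map_apply, hdec]
    have := ih (δ s (S 0) w).1 (Fin.tail S)
      ((fun y => (Fin.cons (δ s (S 0) w).2 y : Fin (T + 1) → ℝ)) ⁻¹' O)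
    rw [ofTransducer] at this
    rw [this, Finset.mul_sum]
    refine Finset.sum_congr rfl fun v _ => ?_
    simp only [Fin.consEquiv_apply, Fin.prod_univ_succ, Fin.cons_zero, Fin.cons_succ, transduce,
      mul_assoc]
    rfl

theorem outputProb_ofTransducer [Fintype Ω] [Fintype ρ] {b W : ℕ} (enc : σ → Memory b W)
    (dec : Memory b W → σ) (hdec : ∀ s, dec (enc s) = s) (ι : PMF ρ) (s₀ : ρ → σ)
    (μ : PMF Ω) (δ : σ → Option U → Ω → σ × ℝ) (T : ℕ) (S : Stream U T) (O : Set (Fin T → ℝ)) :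
    (ofTransducer enc dec ι s₀ μ δ).outputProb S O =
      ∑ r, ι r * ∑ ω : Fin T → Ω, (∏ t, μ (ω t)) * O.indicator 1 (transduce δ T (s₀ r) S ω) := by
  rw [StreamingAlgorithm.outputProb, StreamingAlgorithm.run]
  conv_lhs => rw [ofTransducer]
  rw [PMF.bind_map, PMF.toOuterMeasure_bind_apply, tsum_fintype]
  refine Finset.sum_congr rfl fun r _ => ?_
  rw [← toOuterMeasure_runFrom_ofTransducer enc dec hdec ι s₀]
  rfl

end Transducer

/-! ### Finite sums as probabilities -/

/-- An expectation of a product over independent coordinates is the product of expectations. -/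
theorem sum_pi_prod {ι α : Type*} [Fintype ι] [DecidableEq ι] [Fintype α] (f : ι → α → ℝ) :
    ∑ x : ι → α, ∏ i, f i (x i) = ∏ i, ∑ a, f i a := by
  rw [Finset.prod_univ_sum, Fintype.piFinset_univ]

/-- Markov's inequality for finite weighted sums. -/
theorem sum_filter_le_of_markov {α : Type*} [Fintype α] (w g : α → ℝ) (p : α → Prop)
    [DecidablePred p] {a c : ℝ} (hw : ∀ x, 0 ≤ w x) (hg : ∀ x, 0 ≤ g x) (ha : 0 < a)
    (hp : ∀ x, p x → a ≤ g x) (hc : ∑ x, w x * g x ≤ c) :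
    ∑ x with p x, w x ≤ c / a := by
  rw [le_div_iff₀ ha, Finset.sum_mul]
  refine le_trans (Finset.sum_le_sum fun x hx => ?_)
    ((Finset.sum_le_sum_of_subset_of_nonneg (Finset.filter_subset p univ)
      fun x _ _ => mul_nonneg (hw x) (hg x)).trans hc)
  exact mul_le_mul_of_nonneg_left (hp x (Finset.mem_filter.1 hx).2) (hw x)

/-- The union bound for finite weighted sums. -/
theorem sum_filter_exists_le {α κ : Type*} [Fintype α] [Fintype κ] (w : α → ℝ)
    (p : κ → α → Prop) {c : ℝ} (hw : ∀ x, 0 ≤ w x)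
    (hc : ∀ k, (open Classical in ∑ x with p k x, w x) ≤ c) :
    (open Classical in ∑ x with ∃ k, p k x, w x) ≤ Fintype.card κ * c := by
  classical
  calc _ ≤ ∑ k, ∑ x with p k x, w x := by
        simp only [Finset.sum_filter]
        rw [Finset.sum_comm]
        refine Finset.sum_le_sum fun x _ => ?_
        split_ifs with h
        · obtain ⟨k, hk⟩ := h
          refine le_trans ?_ (Finset.single_le_sum (f := fun k => if p k x then w x else 0)
            (fun k _ => by split_ifs <;> simp [hw]) (Finset.mem_univ k))
          simp [hk]
        · exact Finset.sum_nonneg fun k _ => by split_ifs <;> simp [hw]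
    _ ≤ ∑ _k : κ, c := Finset.sum_le_sum fun k _ => by convert hc k
    _ = _ := by simp

/-! ### Geometric noise on a cyclic group -/

/-- The cyclic distance from `z` to `0`. -/
def cyclicAbs {M : ℕ} (z : ZMod M) : ℝ := |(z.valMinAbs : ℝ)|

/-- The two-sided geometric distribution on `ZMod M`. -/
def noiseWeight {M : ℕ} [NeZero M] (a : ℝ) (z : ZMod M) : ℝ :=
  Real.exp (-a * cyclicAbs z) / ∑ z : ZMod M, Real.exp (-a * cyclicAbs z)

section Noise

variable {M : ℕ}

theorem cyclicAbs_add_le (x y : ZMod M) : cyclicAbs (x + y) ≤ cyclicAbs x + cyclicAbs y := by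
  have h := ZMod.natAbs_valMinAbs_add_le x y
  have h2 := (Nat.cast_le (α := ℝ)).2 h
  rw [Nat.cast_natAbs, Nat.cast_natAbs] at h2
  push_cast at h2
  exact h2.trans (abs_add_le _ _)

variable [NeZero M]

/-- `valMinAbs` is the representative of least absolute value. -/
theorem cyclicAbs_intCast_le (d : ℤ) : cyclicAbs (d : ZMod M) ≤ |(d : ℝ)| := by
  have h := ZMod.natAbs_min_of_le_div_two M (d : ZMod M).valMinAbs d (by simp)
    (ZMod.natAbs_valMinAbs_le _)
  have h2 := (Nat.cast_le (α := ℝ)).2 h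
  rw [Nat.cast_natAbs, Nat.cast_natAbs] at h2
  push_cast at h2
  exact h2

theorem noiseWeight_normalizer_pos (a : ℝ) :
    0 < ∑ z : ZMod M, Real.exp (-a * cyclicAbs z) :=
  Finset.sum_pos (fun _ _ => Real.exp_pos _) ⟨0, Finset.mem_univ _⟩

theorem noiseWeight_nonneg (a : ℝ) (z : ZMod M) : 0 ≤ noiseWeight a z :=
  div_nonneg (Real.exp_pos _).le (noiseWeight_normalizer_pos a).le

theorem sum_noiseWeight (a : ℝ) : ∑ z : ZMod M, noiseWeight a z = 1 := by
  simp only [noiseWeight]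
  rw [← Finset.sum_div, div_self (noiseWeight_normalizer_pos a).ne']

/-- The triangle inequality for the cyclic distance; the normalizer is common to both sides. -/
theorem noiseWeight_le_exp_mul_add {a : ℝ} (ha : 0 ≤ a) (z : ZMod M) (d : ℤ) :
    noiseWeight a z ≤ Real.exp (a * |(d : ℝ)|) * noiseWeight a (z + (d : ZMod M)) := by
  rw [noiseWeight, noiseWeight, ← mul_div_assoc, ← Real.exp_add]
  refine div_le_div_of_nonneg_right (Real.exp_le_exp.2 ?_) (noiseWeight_normalizer_pos a).le
  have h := (cyclicAbs_add_le z (d : ZMod M)).trans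
    (add_le_add_right (cyclicAbs_intCast_le d) _)
  nlinarith

theorem tdiv_two_spec (n : ℤ) :
    (0 ≤ n ∧ 2 * n.tdiv 2 ≤ n ∧ n ≤ 2 * n.tdiv 2 + 1) ∨
      (n < 0 ∧ n ≤ 2 * n.tdiv 2 ∧ 2 * n.tdiv 2 ≤ n + 1) := by
  rw [Int.tdiv_eq_ediv, show Int.sign 2 = 1 from rfl]
  split_ifs <;> omega

/-- Halving the representative is at most three-to-one, and doubling the absolute value of the half
does not exceed the original. Hence the constant is free of `a` and `M`. -/
theorem sum_exp_half_le {a : ℝ} (ha : 0 ≤ a) :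
    ∑ z : ZMod M, Real.exp (-(a / 2) * cyclicAbs z) ≤
      3 * ∑ z : ZMod M, Real.exp (-a * cyclicAbs z) := by
  classical
  let φ : ZMod M → ZMod M := fun z => ((z.valMinAbs.tdiv 2 : ℤ) : ZMod M)
  have hφ (z : ZMod M) : (φ z).valMinAbs = z.valMinAbs.tdiv 2 := by
    refine (ZMod.valMinAbs_spec _ _).2 ⟨rfl, ?_⟩
    have := (ZMod.valMinAbs_mem_Ioc z)
    have h2 := tdiv_two_spec z.valMinAbs
    rw [Set.mem_Ioc] at this ⊢
    have := NeZero.pos M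
    omega
  -- Truncation towards zero sends `-1, 0, 1` to `0`; every other fiber has at most two points.
  have hfib (y : ZMod M) : (univ.filter fun z => φ z = y).card ≤ 3 := by
    have : (univ.filter fun z => φ z = y).image ZMod.valMinAbs ⊆
        if y.valMinAbs = 0 then {-1, 0, 1} else
          if 0 < y.valMinAbs then {2 * y.valMinAbs, 2 * y.valMinAbs + 1}
          else {2 * y.valMinAbs, 2 * y.valMinAbs - 1} := by
      intro n hn
      obtain ⟨z, hz, rfl⟩ := Finset.mem_image.1 hn
      have hz := (Finset.mem_filter.1 hz).2
      have h2 := tdiv_two_spec z.valMinAbs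
      rw [← hz, hφ]
      split_ifs <;> simp only [Finset.mem_insert, Finset.mem_singleton] <;> omega
    have h2 := Finset.card_le_card this
    rw [Finset.card_image_of_injective _ ZMod.injective_valMinAbs] at h2
    refine h2.trans ?_
    split_ifs
    · exact Finset.card_le_three
    · exact Finset.card_le_two.trans (by norm_num)
    · exact Finset.card_le_two.trans (by norm_num)
  calc ∑ z : ZMod M, Real.exp (-(a / 2) * cyclicAbs z)
      ≤ ∑ z : ZMod M, Real.exp (-a * cyclicAbs (φ z)) := by
        refine Finset.sum_le_sum fun z _ => Real.exp_le_exp.2 ?_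
        have h : 2 * cyclicAbs (φ z) ≤ cyclicAbs z := by
          have : 2 * |z.valMinAbs.tdiv 2| ≤ |z.valMinAbs| := by
            have := tdiv_two_spec z.valMinAbs
            rw [Int.abs_eq_natAbs, Int.abs_eq_natAbs]
            omega
          rw [cyclicAbs, cyclicAbs, hφ]
          exact_mod_cast this
        nlinarith
    _ = ∑ y : ZMod M, ∑ z with φ z = y, Real.exp (-a * cyclicAbs (φ z)) :=
        (Finset.sum_fiberwise _ _ _).symm
    _ ≤ ∑ y : ZMod M, 3 * Real.exp (-a * cyclicAbs y) := by
        refine Finset.sum_le_sum fun y _ => ?_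
        rw [Finset.sum_congr rfl (g := fun _ => Real.exp (-a * cyclicAbs y))
          (fun z hz => by rw [(Finset.mem_filter.1 hz).2]), Finset.sum_const, nsmul_eq_mul]
        exact mul_le_mul_of_nonneg_right (by exact_mod_cast hfib y) (Real.exp_pos _).le
    _ = _ := by rw [Finset.mul_sum]

/-- The exponential moment of the noise. -/
theorem sum_noiseWeight_mul_exp_le {a : ℝ} (ha : 0 ≤ a) :
    ∑ z : ZMod M, noiseWeight a z * Real.exp (a / 2 * cyclicAbs z) ≤ 3 := by
  have h (z : ZMod M) : noiseWeight a z * Real.exp (a / 2 * cyclicAbs z) =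
      Real.exp (-(a / 2) * cyclicAbs z) / ∑ z : ZMod M, Real.exp (-a * cyclicAbs z) := by
    rw [noiseWeight, div_mul_eq_mul_div, ← Real.exp_add]
    congr 2
    ring
  simp only [h]
  rw [← Finset.sum_div, div_le_iff₀ (noiseWeight_normalizer_pos a)]
  exact sum_exp_half_le ha

end Noise

/-- The law of independent noise on all coordinates in `ι`. -/
def noiseProd {ι : Type*} [Fintype ι] {M : ℕ} [NeZero M] (a : ℝ) (x : ι → ZMod M) : ℝ :=
  ∏ i, noiseWeight a (x i)

section NoiseProd

variable {ι : Type*} [Fintype ι] {M : ℕ} [NeZero M]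

theorem noiseProd_nonneg (a : ℝ) (x : ι → ZMod M) : 0 ≤ noiseProd a x :=
  Finset.prod_nonneg fun _ _ => noiseWeight_nonneg _ _

theorem sum_noiseProd [DecidableEq ι] (a : ℝ) : ∑ x : ι → ZMod M, noiseProd a x = 1 := by
  simp only [noiseProd]
  rw [sum_pi_prod fun _ z => noiseWeight a z]
  simp [sum_noiseWeight]

theorem noiseProd_le_exp_mul_add {a : ℝ} (ha : 0 ≤ a) (x : ι → ZMod M) (d : ι → ℤ) :
    noiseProd a x ≤
      Real.exp (a * ∑ i, |(d i : ℝ)|) * noiseProd a (x + fun i => (d i : ZMod M)) := by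
  rw [noiseProd, noiseProd, Finset.mul_sum, Real.exp_sum, ← Finset.prod_mul_distrib]
  exact Finset.prod_le_prod (fun _ _ => noiseWeight_nonneg _ _)
    fun i _ => noiseWeight_le_exp_mul_add ha _ _

/-- The tail of the sum of the noise over the coordinates in `J`. -/
theorem sum_noiseProd_filter_le [DecidableEq ι] {a N : ℝ} (ha : 0 ≤ a) (J : Finset ι) :
    (open Classical in ∑ x : ι → ZMod M with N ≤ ∑ i ∈ J, cyclicAbs (x i), noiseProd a x) ≤
      3 ^ J.card * Real.exp (-(a / 2 * N)) := by
  classical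
  -- The exponential moment factorizes: a factor at most `3` for each coordinate in `J`, and `1`
  -- elsewhere.
  have h : ∑ x : ι → ZMod M,
      noiseProd a x * Real.exp (a / 2 * ∑ i ∈ J, cyclicAbs (x i)) ≤ 3 ^ J.card := by
    have (x : ι → ZMod M) : noiseProd a x * Real.exp (a / 2 * ∑ i ∈ J, cyclicAbs (x i)) =
        ∏ i, noiseWeight a (x i) * (if i ∈ J then Real.exp (a / 2 * cyclicAbs (x i)) else 1) := by
      rw [noiseProd, Finset.prod_mul_distrib, Finset.mul_sum, Real.exp_sum, Finset.prod_ite_mem,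
        Finset.univ_inter]
    simp only [this]
    rw [sum_pi_prod fun i z => noiseWeight a z *
      (if i ∈ J then Real.exp (a / 2 * cyclicAbs z) else 1)]
    calc _ ≤ ∏ i, (if i ∈ J then (3 : ℝ) else 1) := by
          refine Finset.prod_le_prod (fun i _ => Finset.sum_nonneg fun z _ => ?_) fun i _ => ?_
          · refine mul_nonneg (noiseWeight_nonneg _ _) ?_
            split_ifs <;> positivity
          · split_ifs
            · exact sum_noiseWeight_mul_exp_le ha
            · simp [sum_noiseWeight]
      _ = 3 ^ J.card := by
          rw [Finset.prod_ite_mem, Finset.univ_inter, Finset.prod_const]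
  have := sum_filter_le_of_markov (noiseProd a)
    (fun x => Real.exp (a / 2 * ∑ i ∈ J, cyclicAbs (x i)))
    (fun x : ι → ZMod M => N ≤ ∑ i ∈ J, cyclicAbs (x i)) (a := Real.exp (a / 2 * N))
    (noiseProd_nonneg a) (fun _ => (Real.exp_pos _).le) (Real.exp_pos _)
    (fun x hx => Real.exp_le_exp.2 (mul_le_mul_of_nonneg_left hx (by positivity))) h
  rw [div_eq_mul_inv, ← Real.exp_neg] at this
  convert this

end NoiseProd

/-! ### A fixed table in place of random hashing -/

/-- A family of events of small probability has a table of outcomes, of size logarithmic in the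
number of events, on which every event has small frequency. -/
theorem exists_table {H κ : Type*} [Fintype H] [Fintype κ] (w : H → ℝ) (hw : ∀ h, 0 ≤ w h)
    (hw1 : ∑ h, w h = 1) (B : κ → H → Prop) {ξ : ℝ}
    (hB : ∀ s, (open Classical in ∑ h with B s h, w h) ≤ ξ / 8) (R : ℕ)
    (hR : Fintype.card κ < Real.exp (ξ * R / 4)) :
    ∃ r : Fin R → H, ∀ s, (open Classical in ((univ.filter fun k => B s (r k)).card : ℝ)) ≤
      ξ / 2 * R := by
  classical
  by_contra! hcon
  -- Probabilistic method: the rows of the table are `R` independent draws.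
  let w' : (Fin R → H) → ℝ := fun r => ∏ k, w (r k)
  have hw' (r) : 0 ≤ w' r := Finset.prod_nonneg fun _ _ => hw _
  have hsum : ∑ r, w' r = 1 := by
    rw [sum_pi_prod fun _ h => w h]
    simp [hw1]
  have key (s : κ) : ∑ r with ξ / 2 * R < ((univ.filter fun k => B s (r k)).card : ℝ), w' r ≤
      Real.exp (-(ξ * R / 4)) := by
    -- Chernoff bound with parameter `1`: each row contributes at most `1 + (e - 1) * ξ / 8 ≤ exp (ξ
    -- / 4)`.
    have h1 : ∑ r : Fin R → H, w' r * Real.exp ((univ.filter fun k => B s (r k)).card : ℝ) ≤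
        Real.exp (ξ * R / 4) := by
      have (r : Fin R → H) : w' r * Real.exp ((univ.filter fun k => B s (r k)).card : ℝ) =
          ∏ k, w (r k) * Real.exp (if B s (r k) then 1 else 0) := by
        rw [Finset.prod_mul_distrib, ← Real.exp_sum, Finset.sum_boole]
      simp only [this]
      rw [sum_pi_prod fun _ h => w h * Real.exp (if B s h then 1 else 0), Finset.prod_const,
        Finset.card_univ, Fintype.card_fin]
      have h2 : ∑ h, w h * Real.exp (if B s h then 1 else 0) ≤ Real.exp (ξ / 4) := by
        have (h : H) : w h * Real.exp (if B s h then 1 else 0) =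
            w h + (Real.exp 1 - 1) * (if B s h then w h else 0) := by
          split_ifs
          · ring
          · simp
        simp only [this]
        rw [Finset.sum_add_distrib, hw1, ← Finset.mul_sum, ← Finset.sum_filter]
        have h0 : 0 ≤ ∑ h with B s h, w h := Finset.sum_nonneg fun h _ => hw h
        have h3 := Real.exp_one_lt_d9
        have h4 := Real.add_one_le_exp (ξ / 4)
        have h5 : (Real.exp 1 - 1) * ∑ h with B s h, w h ≤ 2 * ∑ h with B s h, w h :=
          mul_le_mul_of_nonneg_right (by linarith) h0
        have h6 : ∑ h with B s h, w h ≤ ξ / 8 := by convert hB s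
        linarith
      calc _ ≤ Real.exp (ξ / 4) ^ R := by
            refine pow_le_pow_left₀ (Finset.sum_nonneg fun h _ => ?_) h2 R
            exact mul_nonneg (hw h) (Real.exp_pos _).le
        _ = _ := by rw [← Real.exp_nat_mul]; congr 1; ring
    have := sum_filter_le_of_markov w'
      (fun r => Real.exp ((univ.filter fun k => B s (r k)).card : ℝ))
      (fun r => ξ / 2 * R < ((univ.filter fun k => B s (r k)).card : ℝ))
      (a := Real.exp (ξ / 2 * R)) hw' (fun _ => (Real.exp_pos _).le) (Real.exp_pos _)
      (fun r hr => Real.exp_le_exp.2 hr.le) h1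
    refine this.trans_eq ?_
    rw [← Real.exp_sub]
    congr 1
    ring
  -- If every table failed for some `s`, the union bound would give `1 ≤ card κ * exp (-(ξ * R /
  -- 4))`, against `hR`.
  have hun := sum_filter_exists_le w'
    (fun s r => ξ / 2 * R < ((univ.filter fun k => B s (r k)).card : ℝ)) hw'
    (fun s => by convert key s)
  rw [Finset.filter_true_of_mem fun r _ => by
    obtain ⟨s, hs⟩ := hcon r
    exact ⟨s, by convert hs⟩, hsum, Real.exp_neg, ← div_eq_mul_inv, le_div_iff₀ (Real.exp_pos _),
    one_mul] at hun
  linarith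

/-! ### Sampling at geometric levels -/

/-- The distribution on sampling levels in which level `i ≠ 0` has probability `2 ^ (-i)`. -/
def levelWeight {L : ℕ} (i : Fin (L + 1)) : ℝ := if i = 0 then (1 / 2) ^ L else (1 / 2) ^ (i : ℕ)

/-- The element `u` is sampled at level `i`; level `0` samples everything. -/
def Sampled {U : Type*} {L : ℕ} (h : U → Fin (L + 1)) (i : Fin (L + 1)) (u : U) : Prop :=
  i = 0 ∨ h u = i

open Classical in
/-- The elements of `V` that are sampled at level `i`. -/
def sampledSet {U : Type*} {L : ℕ} (h : U → Fin (L + 1)) (V : Finset U) (i : Fin (L + 1)) :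
    Finset U :=
  V.filter (Sampled h i)

/-- The number of elements of `V` sampled at level `i` deviates from its expectation. -/
def SampleDeviates {U : Type*} {L : ℕ} (e θ : ℝ) (V : Finset U) (i : Fin (L + 1))
    (h : U → Fin (L + 1)) : Prop :=
  e * max ((V.card : ℝ) * (1 / 2) ^ (i : ℕ)) θ <
    |((sampledSet h V i).card : ℝ) - V.card * (1 / 2) ^ (i : ℕ)|

section Sampling

variable {U : Type*} {L : ℕ}

@[simp]
theorem mem_sampledSet {h : U → Fin (L + 1)} {V : Finset U} {i : Fin (L + 1)} {u : U} :
    u ∈ sampledSet h V i ↔ u ∈ V ∧ Sampled h i u := by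
  classical
  simp [sampledSet]

@[simp]
theorem sampledSet_zero (h : U → Fin (L + 1)) (V : Finset U) : sampledSet h V 0 = V := by
  ext u
  simp [Sampled]

theorem levelWeight_nonneg (i : Fin (L + 1)) : 0 ≤ levelWeight i := by
  unfold levelWeight
  split_ifs <;> positivity

/-- The value `0` carries the leftover mass `2 ^ (-L)` of the geometric series. -/
theorem sum_levelWeight : ∑ i : Fin (L + 1), levelWeight i = 1 := by
  rw [Fin.sum_univ_succ]
  simp only [levelWeight, Fin.succ_ne_zero, if_true, if_false, Fin.val_succ]
  rw [Fin.sum_univ_eq_sum_range (fun i => (1 / 2 : ℝ) ^ (i + 1))]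
  induction L with
  | zero => simp
  | succ L ih => rw [Finset.sum_range_succ, pow_succ]; linarith

variable [Fintype U]

/-- The law of independent levels for all elements. -/
def levelLaw (h : U → Fin (L + 1)) : ℝ := ∏ u, levelWeight (h u)

theorem levelLaw_nonneg (h : U → Fin (L + 1)) : 0 ≤ levelLaw h :=
  Finset.prod_nonneg fun _ _ => levelWeight_nonneg _

variable [DecidableEq U]

theorem sum_levelLaw : ∑ h : U → Fin (L + 1), levelLaw h = 1 := by
  classical
  simp only [levelLaw]
  rw [sum_pi_prod fun _ i => levelWeight i]
  simp [sum_levelWeight]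

/-- The events `h u = i` are independent with probability `2 ^ (-i)`, and `exp c - 1 - c ≤ c ^ 2`
for `|c| ≤ 1`. -/
theorem sum_levelLaw_mul_exp_le (V : Finset U) {i : Fin (L + 1)} (hi : i ≠ 0) {c : ℝ}
    (hc : |c| ≤ 1) :
    ∑ h : U → Fin (L + 1), levelLaw h *
      Real.exp (c * (((sampledSet h V i).card : ℝ) - V.card * (1 / 2) ^ (i : ℕ))) ≤
      Real.exp (V.card * (1 / 2) ^ (i : ℕ) * c ^ 2) := by
  classical
  set p : ℝ := (1 / 2) ^ (i : ℕ) with hp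
  have hp0 : 0 ≤ p := by positivity
  have h1 (h : U → Fin (L + 1)) :
      levelLaw h * Real.exp (c * (((sampledSet h V i).card : ℝ) - V.card * p)) =
        ∏ u, levelWeight (h u) *
          (if u ∈ V then Real.exp (c * ((if h u = i then 1 else 0) - p)) else 1) := by
    rw [levelLaw, Finset.prod_mul_distrib, Finset.prod_ite_mem, Finset.univ_inter,
      ← Real.exp_sum, ← Finset.mul_sum, Finset.sum_sub_distrib, Finset.sum_boole]
    have : sampledSet h V i = {x ∈ V | h x = i} := by
      ext u
      simp [Sampled, hi]
    rw [this]
    simp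
  simp only [h1]
  rw [sum_pi_prod fun u j => levelWeight j *
    (if u ∈ V then Real.exp (c * ((if j = i then 1 else 0) - p)) else 1)]
  have h2 : ∑ j : Fin (L + 1), levelWeight j * Real.exp (c * ((if j = i then 1 else 0) - p)) ≤
      Real.exp (p * c ^ 2) := by
    have (j : Fin (L + 1)) : levelWeight j * Real.exp (c * ((if j = i then 1 else 0) - p)) =
        Real.exp (-(c * p)) * (levelWeight j + (if j = i then p * (Real.exp c - 1) else 0)) := by
      split_ifs with hj
      · subst hj
        rw [show c * (1 - p) = -(c * p) + c by ring, Real.exp_add, levelWeight, if_neg hi]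
        ring
      · rw [show c * (0 - p) = -(c * p) by ring]
        ring
    simp only [this]
    rw [← Finset.mul_sum, Finset.sum_add_distrib, sum_levelWeight, Finset.sum_ite_eq' univ i,
      if_pos (Finset.mem_univ _)]
    have h3 := (abs_le.1 (Real.abs_exp_sub_one_sub_id_le hc)).2
    calc Real.exp (-(c * p)) * (1 + p * (Real.exp c - 1))
        ≤ Real.exp (-(c * p)) * Real.exp (p * (Real.exp c - 1)) :=
          mul_le_mul_of_nonneg_left (by linarith [Real.add_one_le_exp (p * (Real.exp c - 1))])
            (Real.exp_pos _).le
      _ = Real.exp (p * (Real.exp c - 1 - c)) := by rw [← Real.exp_add]; congr 1; ring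
      _ ≤ _ := Real.exp_le_exp.2 (mul_le_mul_of_nonneg_left h3 hp0)
  calc _ ≤ ∏ u : U, (if u ∈ V then Real.exp (p * c ^ 2) else 1) := by
        refine Finset.prod_le_prod (fun u _ => Finset.sum_nonneg fun j _ => ?_) fun u _ => ?_
        · refine mul_nonneg (levelWeight_nonneg _) ?_
          split_ifs <;> positivity
        · split_ifs
          · exact h2
          · simp [sum_levelWeight]
    _ = _ := by
        rw [Finset.prod_ite_mem, Finset.univ_inter, Finset.prod_const, ← Real.exp_nat_mul]
        congr 1
        ring

/-- The Chernoff bound for the number of sampled elements. -/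
theorem sum_levelLaw_deviates_le {e θ : ℝ} (he : 0 < e) (he1 : e ≤ 1) (V : Finset U)
    (i : Fin (L + 1)) :
    (open Classical in ∑ h with SampleDeviates e θ V i h, levelLaw h) ≤
      2 * Real.exp (-(e ^ 2 * θ / 4)) := by
  classical
  by_cases hi : i = 0
  · subst hi
    rw [Finset.filter_false_of_mem, Finset.sum_empty]
    · positivity
    · intro h _ hh
      simp only [SampleDeviates, sampledSet_zero,
        Fin.val_zero, pow_zero, mul_one, sub_self, abs_zero] at hh
      have : 0 ≤ e * max (V.card : ℝ) θ := mul_nonneg he.le (le_max_of_le_left (by positivity))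
      linarith
  set μ : ℝ := V.card * (1 / 2) ^ (i : ℕ) with hμ
  set X : (U → Fin (L + 1)) → ℝ := fun h => (sampledSet h V i).card with hX
  have hpos := sum_levelLaw_mul_exp_le V hi (c := e / 2) (by rw [abs_of_pos] <;> linarith)
  have hneg := sum_levelLaw_mul_exp_le V hi (c := -(e / 2))
    (by rw [abs_neg, abs_of_pos] <;> linarith)
  have hsum : ∑ h, levelLaw h * (Real.exp (e / 2 * (X h - μ)) + Real.exp (-(e / 2) * (X h - μ))) ≤
      2 * Real.exp (μ * (e / 2) ^ 2) := by
    simp only [mul_add, Finset.sum_add_distrib]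
    rw [neg_sq] at hneg
    linarith
  have := sum_filter_le_of_markov levelLaw
    (fun h => Real.exp (e / 2 * (X h - μ)) + Real.exp (-(e / 2) * (X h - μ)))
    (SampleDeviates e θ V i) (a := Real.exp (e / 2 * (e * max μ θ))) levelLaw_nonneg
    (fun _ => by positivity) (Real.exp_pos _) (fun h hh => ?_) hsum
  · refine (le_of_eq (by congr)).trans (this.trans ?_)
    rw [mul_div_assoc, ← Real.exp_sub]
    refine mul_le_mul_of_nonneg_left (Real.exp_le_exp.2 ?_) (by norm_num)
    -- With parameter `e / 2` the exponent is `e ^ 2 * μ / 4 - e ^ 2 * max μ θ / 2`, at most `-(e ^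
    -- 2 * θ / 4)`.
    have h1 := mul_le_mul_of_nonneg_left (le_max_left μ θ) (sq_nonneg e)
    have h2 := mul_le_mul_of_nonneg_left (le_max_right μ θ) (sq_nonneg e)
    nlinarith
  · have hh : e * max μ θ < |X h - μ| := hh
    have h1 := Real.exp_pos (e / 2 * (X h - μ))
    have h2 := Real.exp_pos (-(e / 2) * (X h - μ))
    have h3 : Real.exp (e / 2 * (e * max μ θ)) ≤ Real.exp (e / 2 * |X h - μ|) :=
      Real.exp_le_exp.2 (mul_le_mul_of_nonneg_left hh.le (by linarith))
    rcases abs_choice (X h - μ) with h4 | h4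
    · rw [h4] at h3; linarith
    · rw [h4, mul_neg, ← neg_mul] at h3; linarith

end Sampling

/-! ### Elements seen in a prefix -/

open Classical in
/-- The elements among the first `n` inputs. -/
def seen {U : Type*} [Fintype U] {T : ℕ} (S : Stream U T) (n : ℕ) : Finset U :=
  univ.filter fun u => ∃ k : Fin T, (k : ℕ) < n ∧ S k = some u

section Seen

variable {U : Type*} [Fintype U] {T : ℕ}

@[simp]
theorem mem_seen {S : Stream U T} {n : ℕ} {u : U} :
    u ∈ seen S n ↔ ∃ k : Fin T, (k : ℕ) < n ∧ S k = some u := by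
  simp [seen]

theorem seen_mono (S : Stream U T) : Monotone (seen S) := by
  intro m n hmn u
  simp only [mem_seen]
  exact fun ⟨k, hk, h⟩ => ⟨k, hk.trans_le hmn, h⟩

theorem distinctCount_eq_card_seen (S : Stream U T) (t : Fin T) :
    distinctCount S t = (seen S (t + 1)).card := by
  classical
  rw [distinctCount, ← Finset.card_filter]
  congr 1
  ext u
  simp only [frequency, mem_seen, Finset.mem_filter, Finset.mem_univ, true_and,
    Set.ncard_pos (Set.toFinite _), Order.lt_add_one_iff]
  rfl

theorem card_seen_le (S : Stream U T) (n : ℕ) : (seen S n).card ≤ T := by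
  classical
  have : (seen S n).image some ⊆ univ.image S := by
    intro x hx
    obtain ⟨u, hu, rfl⟩ := Finset.mem_image.1 hx
    obtain ⟨k, -, hk⟩ := mem_seen.1 hu
    exact Finset.mem_image.2 ⟨k, Finset.mem_univ _, hk⟩
  have := (Finset.card_le_card this).trans Finset.card_image_le
  rwa [Finset.card_image_of_injective _ (Option.some_injective U), Finset.card_univ,
    Fintype.card_fin] at this

theorem seen_zero (S : Stream U T) : seen S 0 = ∅ := by
  ext u; simp

end Seen

/-! ### The algorithm and a closed form of its output -/

/-- A set of at most `C` elements. -/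
abbrev CappedSet (U : Type*) (C : ℕ) : Type _ := {A : Finset U // A.card ≤ C}

open Classical in
/-- Insert an input into a capped set if it satisfies `p` and the set is not full. -/
def insertCapped {U : Type*} {C : ℕ} (p : U → Prop) (a : Option U) (A : CappedSet U C) :
    CappedSet U C :=
  a.elim A fun u =>
    if h : p u ∧ A.1.card < C then ⟨insert u A.1, (Finset.card_insert_le _ _).trans h.2⟩ else A

/-- The memory of the algorithm: hash seed, time, sampled elements, current noise. -/
abbrev State (U : Type*) (R T L C M : ℕ) : Type _ :=
  Fin R × Fin (T + 1) × (Fin (L + 1) → CappedSet U C) × (Fin (L + 1) × Fin L → ZMod M)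

/-- The initial memory with hash seed `r`. -/
def initialState {U : Type*} {R T L C M : ℕ} (r : Fin R) : State U R T L C M :=
  (r, 0, fun _ => ⟨∅, by simp⟩, 0)

/-- One step of the algorithm with fresh noise `w`. -/
def step {U : Type*} {R T L C M : ℕ} (lev : Fin R → U → Fin (L + 1))
    (est : (Fin (L + 1) → ZMod M) → ℝ) (s : State U R T L C M) (a : Option U)
    (w : Fin (L + 1) × Fin L → ZMod M) : State U R T L C M × ℝ :=
  let A := fun i => insertCapped (Sampled (lev s.1) i) a (s.2.2.1 i)
  -- Cell `(i, j)` is redrawn at multiples of `2 ^ j` and kept in between.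
  let V := fun k : Fin (L + 1) × Fin L =>
    if 2 ^ (k.2 : ℕ) ∣ (s.2.1 : ℕ) + 1 then w k else s.2.2.2 k
  -- The minimum only makes the step total; on a stream of length `T` it never truncates.
  ((s.1, ⟨min (s.2.1 + 1) T, by omega⟩, A, V),
    est fun i => ((A i).1.card : ZMod M) + ∑ j, V (i, j))

/-- The outputs of the algorithm with hash seed `r` on the stream `S` with noise `ω`. -/
def outcome {U : Type*} {R T L M : ℕ} (C : ℕ) (lev : Fin R → U → Fin (L + 1))
    (est : (Fin (L + 1) → ZMod M) → ℝ) (r : Fin R) (S : Stream U T)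
    (ω : Fin T → Fin (L + 1) × Fin L → ZMod M) : Fin T → ℝ :=
  transduce (step (C := C) (T := T) lev est) T (initialState r) S ω

/-- The noise drawn at time `n`, where time starts at `1`. -/
def noiseAt {K : Type*} {T M : ℕ} (ω : Fin T → K → ZMod M) : ℕ → K → ZMod M
  -- Cells not yet redrawn hold their initial value `0`.
  | 0, _ => 0
  | n + 1, k => if h : n < T then ω ⟨n, h⟩ k else 0

/-- The number of sampled elements at level `i` after `n` inputs, capped at `C`. -/
def cappedCount {U : Type*} [Fintype U] {T L : ℕ} (h : U → Fin (L + 1)) (C : ℕ) (S : Stream U T)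
    (i : Fin (L + 1)) (n : ℕ) : ℕ :=
  min C (sampledSet h (seen S n) i).card

section Run

variable {U : Type*} [Fintype U] {R T L C M : ℕ}

/-- The invariant "all sampled elements, or full" determines the size of the stored set as the
capped count, whichever elements were kept. -/
theorem insertCapped_spec (h : U → Fin (L + 1)) (i : Fin (L + 1)) (S : Stream U T) (n : ℕ)
    (hn : n < T) (A : CappedSet U C) (hsub : A.1 ⊆ sampledSet h (seen S n) i)
    (hA : A.1 = sampledSet h (seen S n) i ∨ A.1.card = C) :
    (insertCapped (Sampled h i) (S ⟨n, hn⟩) A).1 ⊆ sampledSet h (seen S (n + 1)) i ∧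
      ((insertCapped (Sampled h i) (S ⟨n, hn⟩) A).1 = sampledSet h (seen S (n + 1)) i ∨
        (insertCapped (Sampled h i) (S ⟨n, hn⟩) A).1.card = C) := by
  classical
  have hmem (v : U) : v ∈ seen S (n + 1) ↔ v ∈ seen S n ∨ S ⟨n, hn⟩ = some v := by
    simp only [mem_seen]
    constructor
    · rintro ⟨k, hk, h⟩
      rcases Nat.lt_succ_iff_lt_or_eq.1 hk with hk | hk
      · exact .inl ⟨k, hk, h⟩
      · refine .inr ?_
        rw [← h]; congr; exact hk.symm
    · rintro (⟨k, hk, h⟩ | h)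
      · exact ⟨k, hk.trans (Nat.lt_succ_self n), h⟩
      · exact ⟨_, Nat.lt_succ_self n, h⟩
  have hmono : sampledSet h (seen S n) i ⊆ sampledSet h (seen S (n + 1)) i := by
    intro v
    simp only [mem_sampledSet, hmem]
    tauto
  unfold insertCapped
  cases ha : S ⟨n, hn⟩ with
  | none =>
    have : sampledSet h (seen S (n + 1)) i = sampledSet h (seen S n) i := by
      ext v; simp only [mem_sampledSet, hmem, ha]; simp
    simp only [Option.elim_none, this]
    exact ⟨hsub, hA⟩
  | some u =>
    simp only [Option.elim_some]
    split_ifs with hu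
    · have hA' := hA.resolve_right hu.2.ne
      have : insert u A.1 = sampledSet h (seen S (n + 1)) i := by
        ext v
        simp only [hA', Finset.mem_insert, mem_sampledSet, hmem, ha, Option.some.injEq]
        constructor
        · rintro (rfl | h)
          · exact ⟨.inr rfl, hu.1⟩
          · exact ⟨.inl h.1, h.2⟩
        · rintro ⟨h | h, h'⟩
          · exact .inr ⟨h, h'⟩
          · exact .inl h.symm
      exact ⟨this.le, .inl this⟩
    · refine ⟨hsub.trans hmono, ?_⟩
      by_cases hC : A.1.card = C
      · exact .inr hC
      · have hlt := lt_of_le_of_ne A.2 hC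
        left
        rw [hA.resolve_right hC]
        ext v
        simp only [mem_sampledSet, hmem, ha, Option.some.injEq]
        constructor
        · exact fun h => ⟨.inl h.1, h.2⟩
        · rintro ⟨h | rfl, h'⟩
          · exact ⟨h, h'⟩
          · exact absurd ⟨h', hlt⟩ hu

theorem stateAt_step (lev : Fin R → U → Fin (L + 1)) (est : (Fin (L + 1) → ZMod M) → ℝ)
    (r : Fin R) (S : Stream U T) (ω : Fin T → Fin (L + 1) × Fin L → ZMod M) (n : ℕ) (hn : n ≤ T) :
    (stateAt (step (C := C) (T := T) lev est) (initialState r) S ω n).1 = r ∧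
    ((stateAt (step (C := C) (T := T) lev est) (initialState r) S ω n).2.1 : ℕ) = n ∧
    (∀ i, ((stateAt (step (C := C) (T := T) lev est) (initialState r) S ω n).2.2.1 i).1 ⊆
        sampledSet (lev r) (seen S n) i ∧
      (((stateAt (step (C := C) (T := T) lev est) (initialState r) S ω n).2.2.1 i).1 =
        sampledSet (lev r) (seen S n) i ∨
        ((stateAt (step (C := C) (T := T) lev est) (initialState r) S ω n).2.2.1 i).1.card = C)) ∧
    ∀ k, (stateAt (step (C := C) (T := T) lev est) (initialState r) S ω n).2.2.2 k =
      noiseAt ω (n / 2 ^ (k.2 : ℕ) * 2 ^ (k.2 : ℕ)) k := by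
  classical
  induction n with
  | zero =>
    refine ⟨rfl, rfl, fun i => ⟨by simp [stateAt, initialState], .inl ?_⟩, fun k => ?_⟩
    · ext u; simp [stateAt, initialState]
    · simp [stateAt, initialState, noiseAt]
  | succ n ih =>
    obtain ⟨h1, h2, h3, h4⟩ := ih (by omega)
    rw [stateAt, dif_pos (by omega : n < T)]
    set s := stateAt (step (C := C) (T := T) lev est) (initialState r) S ω n with hs
    refine ⟨h1, ?_, fun i => ?_, fun k => ?_⟩
    · simp only [step, h2]
      omega
    · have := insertCapped_spec (lev r) i S n hn (s.2.2.1 i) (h3 i).1 (h3 i).2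
      simp only [step, h1]
      exact this
    · simp only [step, h2, h4]
      rw [Nat.succ_div]
      split_ifs with hd
      · have : (n / 2 ^ (k.2 : ℕ) + 1) * 2 ^ (k.2 : ℕ) = n + 1 := by
          rw [← Nat.div_mul_cancel hd, Nat.succ_div, if_pos hd]
        rw [this, noiseAt, dif_pos (by omega : n < T)]
      · rfl

/-- For a fixed seed and noise the stream enters only through its capped counts; this is what
privacy rests on. -/
theorem outcome_apply (lev : Fin R → U → Fin (L + 1)) (est : (Fin (L + 1) → ZMod M) → ℝ)
    (r : Fin R) (S : Stream U T) (ω : Fin T → Fin (L + 1) × Fin L → ZMod M) (t : Fin T) :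
    outcome C lev est r S ω t =
      est fun i => (cappedCount (lev r) C S i (t + 1) : ZMod M) +
        ∑ j : Fin L, noiseAt ω ((t + 1) / 2 ^ (j : ℕ) * 2 ^ (j : ℕ)) (i, j) := by
  obtain ⟨-, -, h3, h4⟩ := stateAt_step (C := C) lev est r S ω (t + 1) t.2
  rw [outcome, transduce_apply]
  rw [stateAt, dif_pos t.2] at h3 h4
  change est _ = _
  congr 1
  funext i
  congr 1
  · rw [cappedCount]
    congr 1
    have hle := ((step (C := C) (T := T) lev est
      (stateAt (step lev est) (initialState r) S ω t) (S t) (ω t)).1.2.2.1 i).2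
    have hle' := Finset.card_le_card (h3 i).1
    rcases (h3 i).2 with h | h
    · rw [h] at hle
      rw [min_eq_right hle, ← h]
      rfl
    · rw [h] at hle'
      rw [min_eq_left hle']
      exact h
  · exact Finset.sum_congr rfl fun j _ => h4 (i, j)

end Run

/-! ### Dyadic translations of the noise -/

/-- The translation of the noise that compensates the change `G` of the counts. -/
def noiseShift {I : Type*} {T L : ℕ} (G : I → ℕ → ℤ) (s : Fin T) (k : I × Fin L) : ℤ :=
  if 2 ^ (k.2 : ℕ) ∣ (s : ℕ) + 1 then
    G k.1 (s + 1) - G k.1 ((s + 1) / 2 ^ ((k.2 : ℕ) + 1) * 2 ^ ((k.2 : ℕ) + 1)) else 0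

section NoiseShift

variable {I : Type*} {T L : ℕ}

/-- Rounding `n` down to a multiple of `2 ^ (j + 1)` may pass through the multiple of `2 ^ j`, so
the cell read at time `n` knows the next rounding. -/
theorem noiseAt_add_noiseShift {M : ℕ} (ω : Fin T → I × Fin L → ZMod M) (G : I → ℕ → ℤ) (n : ℕ)
    (hn : n ≤ T) (i : I) (j : Fin L) :
    noiseAt (ω + fun s k => (noiseShift G s k : ZMod M)) (n / 2 ^ (j : ℕ) * 2 ^ (j : ℕ)) (i, j) =
      noiseAt ω (n / 2 ^ (j : ℕ) * 2 ^ (j : ℕ)) (i, j) +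
        ((G i (n / 2 ^ (j : ℕ) * 2 ^ (j : ℕ)) -
          G i (n / 2 ^ ((j : ℕ) + 1) * 2 ^ ((j : ℕ) + 1)) : ℤ) : ZMod M) := by
  have h1 : n / 2 ^ ((j : ℕ) + 1) = n / 2 ^ (j : ℕ) * 2 ^ (j : ℕ) / 2 ^ ((j : ℕ) + 1) := by
    rw [pow_succ, ← Nat.div_div_eq_div_mul, ← Nat.div_div_eq_div_mul, Nat.mul_div_cancel]
    positivity
  rw [h1]
  have h2 : n / 2 ^ (j : ℕ) * 2 ^ (j : ℕ) ≤ T := (Nat.div_mul_le_self _ _).trans hn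
  have h3 : 2 ^ (j : ℕ) ∣ n / 2 ^ (j : ℕ) * 2 ^ (j : ℕ) := Dvd.intro_left _ rfl
  generalize n / 2 ^ (j : ℕ) * 2 ^ (j : ℕ) = m at h2 h3
  cases m with
  | zero => simp [noiseAt]
  | succ m =>
    simp only [noiseAt, dif_pos (Nat.lt_of_succ_le h2), Pi.add_apply, noiseShift, if_pos h3]

/-- The increments telescope from `G i n` at `j = 0` to `G i 0 = 0` at `j = L`, because `n < 2 ^ L`.
-/
theorem sum_noiseAt_add_noiseShift {M : ℕ} (ω : Fin T → I × Fin L → ZMod M) (G : I → ℕ → ℤ)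
    (hG : ∀ i, G i 0 = 0) (n : ℕ) (hn : n ≤ T) (hT : T < 2 ^ L) (i : I) :
    ∑ j : Fin L, noiseAt (ω + fun s k => (noiseShift G s k : ZMod M))
        (n / 2 ^ (j : ℕ) * 2 ^ (j : ℕ)) (i, j) =
      ∑ j : Fin L, noiseAt ω (n / 2 ^ (j : ℕ) * 2 ^ (j : ℕ)) (i, j) + (G i n : ZMod M) := by
  simp only [noiseAt_add_noiseShift ω G n hn]
  rw [Finset.sum_add_distrib, ← Int.cast_sum,
    Fin.sum_univ_eq_sum_range (fun j => G i (n / 2 ^ j * 2 ^ j) -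
      G i (n / 2 ^ (j + 1) * 2 ^ (j + 1))), Finset.sum_range_sub',
    Nat.div_eq_of_lt (hn.trans_lt hT)]
  simp [hG]

/-- At even multiples of `2 ^ j` the increment vanishes; odd multiples give increments over disjoint
intervals, so their sum is at most the total growth of `A`. -/
theorem sum_monotone_dyadic_le (A : ℕ → ℤ) (hA : Monotone A) (j : ℕ) (T : ℕ) :
    ∑ s ∈ range T, (if 2 ^ j ∣ s + 1 then
        A (s + 1) - A ((s + 1) / 2 ^ (j + 1) * 2 ^ (j + 1)) else 0) ≤
      A (T / 2 ^ j * 2 ^ j) - A 0 := by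
  induction T with
  | zero => simp
  | succ T ih =>
    rw [Finset.sum_range_succ]
    split_ifs with h
    · have h2 : T / 2 ^ j * 2 ^ j ≤ (T + 1) / 2 ^ (j + 1) * 2 ^ (j + 1) := by
        rw [pow_succ, ← Nat.div_div_eq_div_mul, Nat.succ_div, if_pos h, mul_comm (2 ^ j),
          ← mul_assoc]
        exact Nat.mul_le_mul_right _ (by omega)
      have := hA h2
      rw [Nat.div_mul_cancel h]
      linarith
    · rw [Nat.succ_div, if_neg h]
      simpa using ih

theorem sum_abs_noiseShift_le_two (G : I → ℕ → ℤ) (A B : ℕ → ℤ) (hA : Monotone A)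
    (hB : Monotone B) (hA0 : ∀ n, 0 ≤ A n) (hA1 : ∀ n, A n ≤ 1) (hB0 : ∀ n, 0 ≤ B n)
    (hB1 : ∀ n, B n ≤ 1) (i : I) (hG : ∀ n, G i n = A n - B n) (j : Fin L) :
    ∑ s : Fin T, |noiseShift G s (i, j)| ≤ 2 := by
  have h1 := sum_monotone_dyadic_le A hA j T
  have h2 := sum_monotone_dyadic_le B hB j T
  rw [← Fin.sum_univ_eq_sum_range (fun s => if 2 ^ (j : ℕ) ∣ s + 1 then
    A (s + 1) - A ((s + 1) / 2 ^ ((j : ℕ) + 1) * 2 ^ ((j : ℕ) + 1)) else 0)] at h1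
  rw [← Fin.sum_univ_eq_sum_range (fun s => if 2 ^ (j : ℕ) ∣ s + 1 then
    B (s + 1) - B ((s + 1) / 2 ^ ((j : ℕ) + 1) * 2 ^ ((j : ℕ) + 1)) else 0)] at h2
  have h3 : ∑ s : Fin T, |noiseShift G s (i, j)| ≤
      ∑ s : Fin T, (if 2 ^ (j : ℕ) ∣ (s : ℕ) + 1 then
        A (s + 1) - A ((s + 1) / 2 ^ ((j : ℕ) + 1) * 2 ^ ((j : ℕ) + 1)) else 0) +
      ∑ s : Fin T, (if 2 ^ (j : ℕ) ∣ (s : ℕ) + 1 then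
        B (s + 1) - B ((s + 1) / 2 ^ ((j : ℕ) + 1) * 2 ^ ((j : ℕ) + 1)) else 0) := by
    rw [← Finset.sum_add_distrib]
    refine Finset.sum_le_sum fun s _ => ?_
    simp only [noiseShift, hG]
    split_ifs
    · have h4 := hA (Nat.div_mul_le_self ((s : ℕ) + 1) (2 ^ ((j : ℕ) + 1)))
      have h5 := hB (Nat.div_mul_le_self ((s : ℕ) + 1) (2 ^ ((j : ℕ) + 1)))
      rw [abs_le]
      constructor <;> linarith
    · simp
  linarith [hA0 0, hB0 0, hA1 (T / 2 ^ (j : ℕ) * 2 ^ (j : ℕ)), hB1 (T / 2 ^ (j : ℕ) * 2 ^ (j : ℕ))]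

theorem noiseShift_neg (G : I → ℕ → ℤ) (s : Fin T) (k : I × Fin L) :
    noiseShift (-G) s k = -noiseShift G s k := by
  simp only [noiseShift, Pi.neg_apply]
  split_ifs <;> ring

end NoiseShift

/-! ### Sensitivity of the capped counts -/

section Sensitivity

variable {U : Type*} [Fintype U] {T L : ℕ}

theorem seen_update_none_subset [DecidableEq (Fin T)] (S : Stream U T) (t : Fin T) (n : ℕ) :
    seen (Function.update S t none) n ⊆ seen S n := by
  intro v
  simp only [mem_seen]
  rintro ⟨k, hk, h⟩
  refine ⟨k, hk, ?_⟩
  by_cases hkt : k = t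
  · subst hkt; simp at h
  · rwa [Function.update_of_ne hkt] at h

theorem mem_seen_update_none (S : Stream U T) (t : Fin T) (n : ℕ) {v : U} (hv : v ∈ seen S n)
    (hne : S t ≠ some v) : v ∈ seen (Function.update S t none) n := by
  simp only [mem_seen] at hv ⊢
  obtain ⟨k, hk, h⟩ := hv
  refine ⟨k, hk, ?_⟩
  rw [Function.update_of_ne]
  · exact h
  · rintro rfl; exact hne h

/-- Erasing one input changes the capped counts by a difference of monotone `0/1`-functions. -/
theorem exists_monotone_cappedCount_sub (h : U → Fin (L + 1)) (C : ℕ) (S : Stream U T) (t : Fin T)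
    {u : U} (hu : S t = some u) (i : Fin (L + 1)) (hi : Sampled h i u) :
    ∃ A B : ℕ → ℤ, Monotone A ∧ Monotone B ∧ (∀ n, 0 ≤ A n) ∧ (∀ n, A n ≤ 1) ∧ (∀ n, 0 ≤ B n) ∧
      (∀ n, B n ≤ 1) ∧ ∀ n, (cappedCount h C S i n : ℤ) -
        cappedCount h C (Function.update S t none) i n = A n - B n := by
  classical
  set S' := Function.update S t none with hS'
  -- `Q n` says that the erased input no longer matters: `u` occurs elsewhere in the prefix or the
  -- level is full anyway. The counts differ by one exactly when `u` has been seen and `Q` fails.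
  let Q : ℕ → Prop := fun n => u ∈ seen S' n ∨ C ≤ (sampledSet h (seen S' n) i).card
  have hQ : ∀ m n, m ≤ n → Q m → Q n := by
    rintro m n hmn (hm | hm)
    · exact .inl (seen_mono _ hmn hm)
    · refine .inr (hm.trans (Finset.card_le_card fun v hv => ?_))
      rw [mem_sampledSet] at hv ⊢
      exact ⟨seen_mono _ hmn hv.1, hv.2⟩
  refine ⟨fun n => if u ∈ seen S n ∨ Q n then 1 else 0, fun n => if Q n then 1 else 0,
    fun m n hmn => ?_, fun m n hmn => ?_, fun n => ?_, fun n => ?_, fun n => ?_, fun n => ?_,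
    fun n => ?_⟩
  · have h1 := hQ m n hmn
    have h2 := @seen_mono _ _ _ S _ _ hmn u
    simp only
    split_ifs <;> first | omega | tauto
  · have h1 := hQ m n hmn
    simp only
    split_ifs <;> first | omega | tauto
  iterate 4 simp only; split_ifs <;> simp
  by_cases h1 : u ∈ seen S n ∧ u ∉ seen S' n
  · have : sampledSet h (seen S n) i = insert u (sampledSet h (seen S' n) i) := by
      ext v
      simp only [mem_sampledSet, Finset.mem_insert]
      constructor
      · intro hv
        by_cases hvu : v = u
        · exact .inl hvu
        · refine .inr ⟨mem_seen_update_none S t n hv.1 ?_, hv.2⟩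
          rw [hu]
          rintro ⟨⟩
          exact hvu rfl
      · rintro (rfl | hv)
        · exact ⟨h1.1, hi⟩
        · exact ⟨seen_update_none_subset S t n hv.1, hv.2⟩
    have hnot : u ∉ sampledSet h (seen S' n) i := fun hh => h1.2 (mem_sampledSet.1 hh).1
    simp only [cappedCount, this, Finset.card_insert_of_notMem hnot, h1.1, true_or, if_true, Q,
      h1.2, false_or]
    split_ifs <;> omega
  · have : sampledSet h (seen S n) i = sampledSet h (seen S' n) i := by
      ext v
      simp only [mem_sampledSet]
      refine ⟨fun hv => ⟨?_, hv.2⟩, fun hv => ⟨seen_update_none_subset S t n hv.1, hv.2⟩⟩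
      by_cases hvu : v = u
      · subst hvu
        exact not_not.1 fun hh => h1 ⟨hv.1, hh⟩
      · refine mem_seen_update_none S t n hv.1 ?_
        rw [hu]
        rintro ⟨⟩
        exact hvu rfl
    have h2 : (u ∈ seen S n ∨ Q n) ↔ Q n := by
      simp only [Q]
      tauto
    simp only [cappedCount, this, h2, sub_self]

theorem cappedCount_update_none_of_not_sampled (h : U → Fin (L + 1)) (C : ℕ) (S : Stream U T)
    (t : Fin T) (i : Fin (L + 1)) (hi : ∀ u, S t = some u → ¬Sampled h i u) (n : ℕ) :
    cappedCount h C (Function.update S t none) i n = cappedCount h C S i n := by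
  rw [cappedCount, cappedCount]
  congr 2
  ext v
  simp only [mem_sampledSet]
  exact ⟨fun hv => ⟨seen_update_none_subset S t n hv.1, hv.2⟩,
    fun hv => ⟨mem_seen_update_none S t n hv.1 fun hh => hi v hh hv.2, hv.2⟩⟩

/-- The sensitivity of the noisy tree to erasing one input. -/
theorem sum_abs_noiseShift_le (h : U → Fin (L + 1)) (C : ℕ) (S : Stream U T) (t : Fin T) :
    ∑ s : Fin T, ∑ k : Fin (L + 1) × Fin L, |noiseShift (fun i n => (cappedCount h C S i n : ℤ) -
      cappedCount h C (Function.update S t none) i n) s k| ≤ 4 * L := by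
  classical
  set G : Fin (L + 1) → ℕ → ℤ := fun i n => (cappedCount h C S i n : ℤ) -
    cappedCount h C (Function.update S t none) i n with hG
  cases hu : S t with
  | none =>
    have : G = 0 := by
      funext i n
      simp [hG, cappedCount_update_none_of_not_sampled h C S t i (by simp [hu])]
    simp [this, noiseShift]
  | some u =>
    rw [Finset.sum_comm, Fintype.sum_prod_type]
    -- An element is sampled only at levels `0` and `h u`; each contributes at most `2` for every
    -- `j`.
    calc _ ≤ ∑ i : Fin (L + 1), ∑ _j : Fin L, if i ∈ ({0, h u} : Finset _) then (2 : ℤ) else 0 := by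
          refine Finset.sum_le_sum fun i _ => Finset.sum_le_sum fun j _ => ?_
          split_ifs with hi
          · obtain ⟨A, B, hA, hB, hA0, hA1, hB0, hB1, hAB⟩ :=
              exists_monotone_cappedCount_sub h C S t hu i (by
                rcases Finset.mem_insert.1 hi with rfl | hi
                · exact .inl rfl
                · exact .inr (Finset.mem_singleton.1 hi).symm)
            exact sum_abs_noiseShift_le_two G A B hA hB hA0 hA1 hB0 hB1 i hAB j
          · have hi' : ∀ v, S t = some v → ¬Sampled h i v := by
              intro v hv hs
              rw [hu, Option.some.injEq] at hv
              subst hv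
              rcases hs with rfl | rfl <;> simp at hi
            have (n : ℕ) : G i n = 0 := by
              simp [hG, cappedCount_update_none_of_not_sampled h C S t i hi']
            simp [noiseShift, this]
      _ = ∑ i ∈ ({0, h u} : Finset (Fin (L + 1))), ∑ _j : Fin L, (2 : ℤ) := by
          rw [← Finset.sum_filter_add_sum_filter_not univ (· ∈ ({0, h u} : Finset (Fin (L + 1)))),
            Finset.sum_eq_zero (s := filter (· ∉ ({0, h u} : Finset (Fin (L + 1)))) univ), add_zero,
            Finset.filter_mem_eq_inter, Finset.univ_inter]
          · exact Finset.sum_congr rfl fun i hi => by simp only [if_pos hi]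
          · intro i hi
            simp only [if_neg (Finset.mem_filter.1 hi).2, Finset.sum_const_zero]
      _ ≤ 4 * L := by
          have : ((({0, h u} : Finset (Fin (L + 1))).card : ℕ) : ℤ) ≤ 2 := by
            exact_mod_cast Finset.card_le_two
          simp only [Finset.sum_const, Finset.card_univ, Fintype.card_fin, nsmul_eq_mul]
          nlinarith

end Sensitivity

/-! ### Privacy by translation -/

/-- The probability that the outcome `f ω` lies in `O` for independent noise `ω`. -/
def noiseProb {T M : ℕ} [NeZero M] {K Y : Type*} [Fintype K] [DecidableEq K] (a : ℝ)
    (f : (Fin T → K → ZMod M) → Y) (O : Set Y) : ℝ :=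
  ∑ ω, (∏ t, noiseProd a (ω t)) * O.indicator 1 (f ω)

section NoiseProb

variable {T M : ℕ} [NeZero M] {K Y : Type*} [Fintype K] [DecidableEq K]

theorem noiseProb_nonneg (a : ℝ) (f : (Fin T → K → ZMod M) → Y) (O : Set Y) :
    0 ≤ noiseProb a f O :=
  Finset.sum_nonneg fun _ _ => mul_nonneg (Finset.prod_nonneg fun _ _ => noiseProd_nonneg _ _)
    (Set.indicator_nonneg (fun _ _ => zero_le_one) _)

/-- Translation by `D` permutes the noise arrays, turns `f'` into `f`, and changes the weight by at
most the stated factor. -/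
theorem noiseProb_le_exp_mul {a : ℝ} (ha : 0 ≤ a) (f f' : (Fin T → K → ZMod M) → Y)
    (D : Fin T → K → ℤ) (hD : ∀ ω, f' (ω + fun s k => (D s k : ZMod M)) = f ω) {B : ℝ}
    (hB : ∑ s, ∑ k, |(D s k : ℝ)| ≤ B) (O : Set Y) :
    noiseProb a f O ≤ Real.exp (a * B) * noiseProb a f' O := by
  have h := Equiv.sum_comp (Equiv.addRight (fun s k => (D s k : ZMod M) : Fin T → K → ZMod M))
    (fun ω => (∏ t, noiseProd a (ω t)) * O.indicator (1 : Y → ℝ) (f' ω))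
  rw [noiseProb, noiseProb, ← h, Finset.mul_sum]
  refine Finset.sum_le_sum fun ω _ => ?_
  rw [Equiv.coe_addRight, hD, ← mul_assoc]
  refine mul_le_mul_of_nonneg_right ?_ (Set.indicator_nonneg (fun _ _ => zero_le_one) _)
  calc ∏ t, noiseProd a (ω t)
      ≤ ∏ t, (Real.exp (a * ∑ k, |(D t k : ℝ)|) *
          noiseProd a (ω t + fun k => (D t k : ZMod M))) :=
        Finset.prod_le_prod (fun _ _ => noiseProd_nonneg _ _)
          fun t _ => noiseProd_le_exp_mul_add ha _ _
    _ = Real.exp (a * ∑ s, ∑ k, |(D s k : ℝ)|) *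
          ∏ t, noiseProd a (ω t + fun k => (D t k : ZMod M)) := by
        rw [Finset.prod_mul_distrib, ← Real.exp_sum, ← Finset.mul_sum]
    _ ≤ _ := mul_le_mul_of_nonneg_right (Real.exp_le_exp.2 (mul_le_mul_of_nonneg_left hB ha))
        (Finset.prod_nonneg fun _ _ => noiseProd_nonneg _ _)

end NoiseProb

/-! ### Memory size and existence of the private algorithm -/

section Algorithm

variable {U : Type*} [Fintype U] {R T L C M : ℕ}

/-- Every capped set is listed by a `C`-tuple with blanks, at one word per entry. -/
theorem card_cappedSet_le (b : ℕ) (hb : Fintype.card U + 1 ≤ 2 ^ b) :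
    Nat.card (CappedSet U C) ≤ 2 ^ (b * C) := by
  classical
  let f : (Fin C → Option U) → CappedSet U C := fun g =>
    ⟨(univ.image g).eraseNone, by
      rw [Finset.card_eraseNone_eq_card_erase]
      refine (Finset.card_erase_le).trans (Finset.card_image_le.trans (by simp))⟩
  have hf : Function.Surjective f := by
    rintro ⟨A, hA⟩
    refine ⟨fun k => if h : (k : ℕ) < A.card then some (A.equivFin.symm ⟨k, h⟩).1 else none, ?_⟩
    apply Subtype.ext
    ext u
    simp only [f, Finset.mem_eraseNone, Finset.mem_image, Finset.mem_univ, true_and]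
    constructor
    · rintro ⟨k, hk⟩
      split_ifs at hk with h
      rw [Option.some.injEq] at hk
      rw [← hk]
      exact (A.equivFin.symm ⟨k, h⟩).2
    · intro hu
      refine ⟨⟨A.equivFin ⟨u, hu⟩, (A.equivFin ⟨u, hu⟩).2.trans_le hA⟩, ?_⟩
      simp
  calc Nat.card (CappedSet U C) ≤ Nat.card (Fin C → Option U) :=
        Nat.card_le_card_of_surjective f hf
    _ = (Fintype.card U + 1) ^ C := by simp [Nat.card_eq_fintype_card]
    _ ≤ (2 ^ b) ^ C := Nat.pow_le_pow_left hb C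
    _ = 2 ^ (b * C) := (pow_mul _ _ _).symm

theorem card_state_le (b w : ℕ) (hb : Fintype.card U + T + 1 ≤ 2 ^ b) (hb1 : 1 ≤ b)
    (hR : R ≤ 2 ^ (b * w)) :
    Nat.card (State U R T L C M) ≤
      2 ^ (b * (w + 1 + C * (L + 1) + M * ((L + 1) * L))) := by
  -- A noise cell is generously charged `M` words; `M` is itself polynomial in the allowed quantity.
  have hM : M ≤ 2 ^ (b * M) :=
    (Nat.lt_two_pow_self).le.trans (Nat.pow_le_pow_right (by norm_num)
      (Nat.le_mul_of_pos_left M hb1))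
  have hC := Nat.pow_le_pow_left (card_cappedSet_le (U := U) (C := C) b (by omega)) (L + 1)
  have hV := Nat.pow_le_pow_left hM ((L + 1) * L)
  have hT : T + 1 ≤ 2 ^ b := by omega
  simp only [State, Nat.card_prod, Nat.card_fun, Nat.card_zmod, Nat.card_fin]
  calc _ ≤ 2 ^ (b * w) * (2 ^ b * ((2 ^ (b * C)) ^ (L + 1) * (2 ^ (b * M)) ^ ((L + 1) * L))) :=
        Nat.mul_le_mul hR (Nat.mul_le_mul hT (Nat.mul_le_mul hC hV))
    _ = _ := by
        rw [← pow_mul, ← pow_mul, ← pow_add, ← pow_add, ← pow_add]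
        congr 1
        ring

variable [NeZero M]

theorem noiseProb_update_none (lev : Fin R → U → Fin (L + 1)) (est : (Fin (L + 1) → ZMod M) → ℝ)
    {a : ℝ} (ha : 0 ≤ a) (hT : T < 2 ^ L) (r : Fin R) (S : Stream U T) (t : Fin T)
    (O : Set (Fin T → ℝ)) :
    noiseProb a (outcome C lev est r S) O ≤
        Real.exp (a * (4 * L)) * noiseProb a
          (outcome C lev est r (Function.update S t none)) O ∧
      noiseProb a
          (outcome C lev est r (Function.update S t none)) O ≤
        Real.exp (a * (4 * L)) *
          noiseProb a (outcome C lev est r S) O := by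
  set S' := Function.update S t none with hS'
  set G : Fin (L + 1) → ℕ → ℤ := fun i n => (cappedCount (lev r) C S i n : ℤ) -
    cappedCount (lev r) C S' i n with hG
  have hG0 (i) : G i 0 = 0 := by
    simp only [hG, cappedCount, seen_zero, sub_self]
  have hsens : ∑ s : Fin T, ∑ k : Fin (L + 1) × Fin L, |(noiseShift G s k : ℝ)| ≤ 4 * L := by
    have := sum_abs_noiseShift_le (lev r) C S t
    rw [← Int.cast_le (R := ℝ)] at this
    push_cast at this
    simpa only [hG, hS'] using this
  constructor
  · refine noiseProb_le_exp_mul ha _ _ (noiseShift G) (fun ω => ?_) hsens O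
    funext n
    rw [outcome_apply, outcome_apply]
    congr 1
    funext i
    rw [sum_noiseAt_add_noiseShift ω G hG0 _ n.2 hT]
    simp only [hG]
    push_cast
    ring
  · refine noiseProb_le_exp_mul ha _ _ (noiseShift (-G)) (fun ω => ?_) ?_ O
    · funext n
      rw [outcome_apply, outcome_apply]
      congr 1
      funext i
      rw [sum_noiseAt_add_noiseShift ω (-G) (by simp [hG0]) _ n.2 hT]
      simp only [hG, Pi.neg_apply]
      push_cast
      ring
    · simpa only [noiseShift_neg, Int.cast_neg, abs_neg] using hsens

/-- Erasing the differing timestamp makes the streams equal, so two erasures at cost `4 * L` each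
suffice. -/
theorem noiseProb_le_of_neighboring (lev : Fin R → U → Fin (L + 1))
    (est : (Fin (L + 1) → ZMod M) → ℝ) {a : ℝ} (ha : 0 ≤ a) (hT : T < 2 ^ L) (r : Fin R)
    {S S' : Stream U T} (hS : Neighboring S S') (O : Set (Fin T → ℝ)) :
    noiseProb a (outcome C lev est r S) O ≤
      Real.exp (a * (8 * L)) *
        noiseProb a (outcome C lev est r S') O := by
  obtain ⟨t, ht⟩ := hS
  have h : Function.update S t none = Function.update S' t none := by
    funext i
    by_cases hi : i = t
    · subst hi; simp
    · simp [hi, ht i hi]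
  have h1 := (noiseProb_update_none (C := C) lev est ha hT r S t O).1
  have h2 := (noiseProb_update_none (C := C) lev est ha hT r S' t O).2
  rw [h] at h1
  refine h1.trans ((mul_le_mul_of_nonneg_left h2 (Real.exp_pos _).le).trans_eq ?_)
  rw [← mul_assoc, ← Real.exp_add]
  ring_nf

/-- The probability of an output history over a uniform hash seed and independent noise. -/
def outcomeProb (C : ℕ) (a : ℝ) (lev : Fin R → U → Fin (L + 1))
    (est : (Fin (L + 1) → ZMod M) → ℝ) (S : Stream U T) (O : Set (Fin T → ℝ)) : ℝ :=
  ∑ r, (R : ℝ)⁻¹ * noiseProb a (outcome C lev est r S) O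

theorem exists_streamingAlgorithm (C w : ℕ) {a : ℝ} (ha : 0 ≤ a) (hR0 : 0 < R)
    (hR : R ≤ 2 ^ (wordSize U T * w)) (hT0 : 1 ≤ T) (hT : T < 2 ^ L)
    (lev : Fin R → U → Fin (L + 1)) (est : (Fin (L + 1) → ZMod M) → ℝ) :
    ∃ A : StreamingAlgorithm U (wordSize U T) (w + 1 + C * (L + 1) + M * ((L + 1) * L)),
      A.IsDP T (a * (8 * L)) ∧ ∀ (S : Stream U T) (O : Set (Fin T → ℝ)),
        A.outputProb S O = ENNReal.ofReal (outcomeProb C a lev est S O) := by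
  classical
  have hb : Fintype.card U + T + 1 ≤ 2 ^ wordSize U T := Nat.le_pow_clog (by norm_num) _
  have hb1 : 1 ≤ wordSize U T := Nat.clog_pos (by norm_num) (by omega)
  have hcard := card_state_le (R := R) (L := L) (C := C) (M := M) _ w hb hb1 hR
  have : Nonempty (Fin R) := ⟨⟨0, hR0⟩⟩
  have : Nonempty (State U R T L C M) := ⟨initialState ⟨0, hR0⟩⟩
  obtain ⟨enc⟩ : Nonempty (State U R T L C M ↪ Memory (wordSize U T)
      (w + 1 + C * (L + 1) + M * ((L + 1) * L))) := by
    refine Function.Embedding.nonempty_of_card_le ?_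
    rw [← Nat.card_eq_fintype_card]
    simpa [← pow_mul] using hcard
  have hsum : ∑ x : Fin (L + 1) × Fin L → ZMod M, ENNReal.ofReal (noiseProd a x) = 1 := by
    rw [← ENNReal.ofReal_sum_of_nonneg fun _ _ => noiseProd_nonneg _ _, sum_noiseProd,
      ENNReal.ofReal_one]
  have hprob (S : Stream U T) (O : Set (Fin T → ℝ)) :
      (ofTransducer enc (Function.invFun enc) (PMF.uniformOfFintype (Fin R)) initialState
        (PMF.ofFintype _ hsum) (step lev est)).outputProb S O =
        ENNReal.ofReal (outcomeProb C a lev est S O) := by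
    have hnn (r : Fin R) (ω : Fin T → Fin (L + 1) × Fin L → ZMod M) :
        0 ≤ (∏ t, noiseProd a (ω t)) * O.indicator (1 : (Fin T → ℝ) → ℝ)
          (outcome C lev est r S ω) :=
      mul_nonneg (Finset.prod_nonneg fun _ _ => noiseProd_nonneg _ _)
        (Set.indicator_nonneg (fun _ _ => zero_le_one) _)
    rw [outputProb_ofTransducer _ _ (Function.leftInverse_invFun enc.injective), outcomeProb,
      ENNReal.ofReal_sum_of_nonneg fun r _ => mul_nonneg (by positivity) (noiseProb_nonneg _ _ _)]
    refine Finset.sum_congr rfl fun r _ => ?_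
    rw [ENNReal.ofReal_mul (by positivity), PMF.uniformOfFintype_apply, Fintype.card_fin,
      ENNReal.ofReal_inv_of_pos (by exact_mod_cast hR0), ENNReal.ofReal_natCast, noiseProb,
      ENNReal.ofReal_sum_of_nonneg fun ω _ => hnn r ω]
    congr 1
    refine Finset.sum_congr rfl fun ω _ => ?_
    rw [ENNReal.ofReal_mul (Finset.prod_nonneg fun _ _ => noiseProd_nonneg _ _),
      ENNReal.ofReal_prod_of_nonneg fun _ _ => noiseProd_nonneg _ _]
    congr 1
    rw [outcome]
    by_cases h : transduce (step (C := C) (T := T) lev est) T (initialState r) S ω ∈ O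
    · simp [h]
    · simp [h]
  refine ⟨_, fun S S' hS O => ?_, hprob⟩
  rw [hprob, hprob, ← ENNReal.ofReal_mul (Real.exp_pos _).le]
  refine ENNReal.ofReal_le_ofReal ?_
  rw [outcomeProb, outcomeProb, Finset.mul_sum]
  refine Finset.sum_le_sum fun r _ => ?_
  rw [mul_left_comm]
  exact mul_le_mul_of_nonneg_left (noiseProb_le_of_neighboring lev est ha hT r hS O)
    (by positivity)

end Algorithm

/-! ### The estimator and absence of wraparound -/

open Classical in
/-- The estimate of the number of distinct elements from the noisy counts of all levels: the first
level on which at most half of the capacity `C` is used is scaled up. -/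
def estimate {L : ℕ} (C : ℕ) (F : Fin (L + 1) → ℤ) : ℝ :=
  if h : (univ.filter fun i => 2 * F i ≤ C).Nonempty then
    2 ^ ((univ.filter fun i => 2 * F i ≤ C).min' h : ℕ) *
      (F ((univ.filter fun i => 2 * F i ≤ C).min' h) : ℝ)
  else 0

theorem abs_estimate_sub_le {L C n : ℕ} (F : Fin (L + 1) → ℤ) (c : Fin (L + 1) → ℕ) {e θ N : ℝ}
    (he : 0 < e) (he1 : e ≤ 1 / 16) (hθ : 1 ≤ θ) (hN : 0 ≤ N) (hCθ : 16 * θ ≤ C)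
    (hCN : 16 * N ≤ e * C) (hc0 : c 0 = n) (hn : n ≤ 2 ^ L)
    (hc : ∀ i : Fin (L + 1), |(c i : ℝ) - n * (1 / 2) ^ (i : ℕ)| ≤
      e * max ((n : ℝ) * (1 / 2) ^ (i : ℕ)) θ)
    (hF : ∀ i, |(F i : ℝ) - (min C (c i) : ℕ)| ≤ N) :
    |estimate C F - n| ≤ 2 * e * n + N := by
  classical
  have hC0 : (16 : ℝ) ≤ C := by linarith
  have hNC : N ≤ C / 256 := by nlinarith
  have hn0 : (0 : ℝ) ≤ n := n.cast_nonneg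
  -- A level with expected count at most `θ` is always eligible. The last level is one, so the
  -- selection is nonempty.
  have hlow (i : Fin (L + 1)) (hi : (n : ℝ) * (1 / 2) ^ (i : ℕ) ≤ θ) : 2 * F i ≤ C := by
    have h1 := (abs_le.1 (hc i)).2
    rw [max_eq_right hi] at h1
    have h2 := (abs_le.1 (hF i)).2
    have h3 : ((min C (c i) : ℕ) : ℝ) ≤ c i := by exact_mod_cast min_le_right _ _
    have h4 : e * θ ≤ 1 / 16 * θ := mul_le_mul_of_nonneg_right he1 (by linarith)
    have : 2 * (F i : ℝ) ≤ C := by linarith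
    exact_mod_cast this
  have hex : (univ.filter fun i => 2 * F i ≤ C).Nonempty := by
    refine ⟨Fin.last L, Finset.mem_filter.2 ⟨Finset.mem_univ _, hlow _ ?_⟩⟩
    refine le_trans ?_ hθ
    rw [Fin.val_last, one_div, inv_pow, ← div_eq_mul_inv, div_le_one (by positivity)]
    exact_mod_cast hn
  rw [estimate, dif_pos hex]
  set i := (univ.filter fun i => 2 * F i ≤ C).min' hex with hi
  have hFi : 2 * (F i : ℝ) ≤ C := by
    have := (Finset.mem_filter.1 (Finset.min'_mem _ hex)).2
    exact_mod_cast this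
  have hci : |(F i : ℝ) - c i| ≤ N := by
    have h1 := hF i
    -- A full level would read at least `C - N > C / 2`, so the selected one is uncapped.
    have h2 : c i < C := by
      by_contra! h
      rw [min_eq_left h] at h1
      have := (abs_le.1 h1).1
      linarith
    rwa [min_eq_right h2.le] at h1
  by_cases hi0 : i = 0
  · rw [hi0] at hci ⊢
    rw [hc0] at hci
    simp only [Fin.val_zero, pow_zero, one_mul]
    have : 0 ≤ 2 * e * n := by positivity
    linarith
  obtain ⟨k, hk⟩ := Fin.exists_succ_eq.2 hi0
  have hkF : (C : ℝ) < 2 * F k.castSucc := by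
    by_contra! h
    have h1 : k.castSucc ∈ univ.filter fun i => 2 * F i ≤ C :=
      Finset.mem_filter.2 ⟨Finset.mem_univ _, by exact_mod_cast h⟩
    have h2 := Finset.min'_le _ _ h1
    rw [← hi, ← hk] at h2
    exact absurd h2 (not_le.2 (Fin.castSucc_lt_succ))
  have hkθ : θ < (n : ℝ) * (1 / 2) ^ (k : ℕ) := by
    by_contra! h
    have := hlow k.castSucc h
    have : 2 * (F k.castSucc : ℝ) ≤ C := by exact_mod_cast this
    linarith
  have hkc := (abs_le.1 (hc k.castSucc)).2
  rw [Fin.val_castSucc, max_eq_left hkθ.le] at hkc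
  have hkF' := (abs_le.1 (hF k.castSucc)).2
  have hmin : ((min C (c k.castSucc) : ℕ) : ℝ) ≤ c k.castSucc := by
    exact_mod_cast min_le_right _ _
  have hik : (i : ℕ) = k + 1 := by rw [← hk, Fin.val_succ]
  set μ : ℝ := n * (1 / 2) ^ (i : ℕ) with hμ
  have hμk : (n : ℝ) * (1 / 2) ^ (k : ℕ) = 2 * μ := by
    rw [hμ, hik, pow_succ]
    ring
  rw [hμk] at hkc hkθ
  have hμ0 : 0 ≤ μ := by positivity
  -- The rejected level `k` has expectation `2 * μ` and noisy count above `C / 2`. Thus `μ`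
  -- dominates `θ`, and `N ≤ e * μ`.
  have hμC : (C : ℝ) / 8 ≤ μ := by nlinarith
  have hθμ : θ ≤ μ := by linarith
  have hcμ := hc i
  rw [max_eq_left hθμ] at hcμ
  have hNμ : N ≤ e * μ := by nlinarith
  have h1 : |(F i : ℝ) - μ| ≤ 2 * e * μ := by
    have := abs_sub_le (F i : ℝ) (c i) μ
    linarith
  have h2 : (2 : ℝ) ^ (i : ℕ) * μ = n := by
    rw [hμ, mul_left_comm, ← mul_pow]
    norm_num
  have h3 : |(2 : ℝ) ^ (i : ℕ) * F i - n| = 2 ^ (i : ℕ) * |(F i : ℝ) - μ| := by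
    rw [← h2, ← mul_sub, abs_mul, abs_of_pos (by positivity)]
  rw [h3]
  calc (2 : ℝ) ^ (i : ℕ) * |(F i : ℝ) - μ| ≤ 2 ^ (i : ℕ) * (2 * e * μ) :=
        mul_le_mul_of_nonneg_left h1 (by positivity)
    _ = 2 * e * n := by rw [← h2]; ring
    _ ≤ _ := by linarith

/-- Small noise does not wrap around. -/
theorem abs_valMinAbs_add_sum_sub_le {M c C : ℕ} [NeZero M] {κ : Type*} (J : Finset κ)
    (z : κ → ZMod M) {N : ℝ} (hc : c ≤ C) (hM : 2 * (C + N) < M)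
    (hz : ∑ j ∈ J, cyclicAbs (z j) ≤ N) :
    |(((c : ZMod M) + ∑ j ∈ J, z j).valMinAbs : ℝ) - c| ≤ N := by
  have h1 : |((∑ j ∈ J, (z j).valMinAbs : ℤ) : ℝ)| ≤ N := by
    refine le_trans ?_ hz
    push_cast
    exact Finset.abs_sum_le_sum_abs _ _
  have hcC : (c : ℝ) ≤ C := by exact_mod_cast hc
  have h2 := abs_le.1 h1
  have : ((c : ZMod M) + ∑ j ∈ J, z j).valMinAbs = c + ∑ j ∈ J, (z j).valMinAbs := by
    refine (ZMod.valMinAbs_spec _ _).2 ⟨by push_cast; simp, ?_, ?_⟩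
    · have : -(M : ℝ) < (((c : ℤ) + ∑ j ∈ J, (z j).valMinAbs : ℤ) : ℝ) * 2 := by
        rw [Int.cast_add, Int.cast_natCast]
        linarith [(c.cast_nonneg : (0 : ℝ) ≤ c), (C.cast_nonneg : (0 : ℝ) ≤ C)]
      exact_mod_cast this
    · have : (((c : ℤ) + ∑ j ∈ J, (z j).valMinAbs : ℤ) : ℝ) * 2 ≤ (M : ℝ) := by
        rw [Int.cast_add, Int.cast_natCast]
        linarith
      exact_mod_cast this
  rw [this, Int.cast_add, Int.cast_natCast, add_sub_cancel_left]
  exact h1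

/-! ### Noise tails and accuracy with high probability -/

section NoiseTail

variable {T M L : ℕ}

theorem noiseAt_of_pos {K : Type*} (ω : Fin T → K → ZMod M) {m : ℕ} (hm : 0 < m) (hmT : m ≤ T)
    (k : K) : noiseAt ω m k = ω ⟨m - 1, by omega⟩ k := by
  obtain ⟨m, rfl⟩ := Nat.exists_eq_succ_of_ne_zero hm.ne'
  exact dif_pos hmT

variable [NeZero M]

theorem sum_prod_noiseProd_filter {K : Type*} [Fintype K] [DecidableEq K] (a : ℝ)
    (p : (Fin T → K → ZMod M) → Prop) :
    (open Classical in ∑ ω with p ω, ∏ t, noiseProd a (ω t)) =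
      (open Classical in ∑ x : Fin T × K → ZMod M with p (Function.curry x), noiseProd a x) := by
  classical
  rw [Finset.sum_filter, Finset.sum_filter, ← (Equiv.curry (Fin T) K (ZMod M)).sum_comp]
  refine Finset.sum_congr rfl fun x _ => ?_
  simp only [Equiv.curry_apply, noiseProd, Fintype.prod_prod_type, Function.curry]

theorem sum_prod_noiseProd {K : Type*} [Fintype K] [DecidableEq K] (a : ℝ) :
    ∑ ω : Fin T → K → ZMod M, ∏ t, noiseProd a (ω t) = 1 := by
  classical
  have := sum_prod_noiseProd_filter (T := T) (M := M) (K := K) a fun _ => True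
  simp only [Finset.filter_true] at this
  rw [this, sum_noiseProd]

/-- The tail of the noise that is added to the count of level `i` at time `n`. -/
theorem noiseAt_tail {a N : ℝ} (ha : 0 ≤ a) (i : Fin (L + 1)) (n : ℕ) (hn : n ≤ T) (hT : 1 ≤ T) :
    (open Classical in ∑ ω : Fin T → Fin (L + 1) × Fin L → ZMod M with
      N < ∑ j : Fin L, cyclicAbs (noiseAt ω (n / 2 ^ (j : ℕ) * 2 ^ (j : ℕ)) (i, j)),
      ∏ t, noiseProd a (ω t)) ≤ 3 ^ L * Real.exp (-(a / 2 * N)) := by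
  classical
  let f : Fin L → Fin T × (Fin (L + 1) × Fin L) := fun j =>
    (⟨n / 2 ^ (j : ℕ) * 2 ^ (j : ℕ) - 1, by
      have := Nat.div_mul_le_self n (2 ^ (j : ℕ)); omega⟩, (i, j))
  have hf : Function.Injective f := fun j j' h => (Prod.ext_iff.1 (Prod.ext_iff.1 h).2).2
  -- Rounding to time `0` reads no noise; discarding these `j` also makes the truncated `- 1` in `f`
  -- harmless.
  let J := univ.filter fun j : Fin L => 0 < n / 2 ^ (j : ℕ) * 2 ^ (j : ℕ)
  have hJ : (J.image f).card ≤ L := by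
    refine Finset.card_image_le.trans ((Finset.card_filter_le _ _).trans ?_)
    simp
  have hsum (x : Fin T × (Fin (L + 1) × Fin L) → ZMod M) :
      ∑ j : Fin L, cyclicAbs (noiseAt (Function.curry x)
        (n / 2 ^ (j : ℕ) * 2 ^ (j : ℕ)) (i, j)) = ∑ k ∈ J.image f, cyclicAbs (x k) := by
    rw [Finset.sum_image hf.injOn, Finset.sum_filter]
    refine Finset.sum_congr rfl fun j _ => ?_
    have hle : n / 2 ^ (j : ℕ) * 2 ^ (j : ℕ) ≤ T := (Nat.div_mul_le_self _ _).trans hn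
    split_ifs with h
    · rw [noiseAt_of_pos _ h hle]
      rfl
    · rw [Nat.eq_zero_of_not_pos h]
      simp [noiseAt, cyclicAbs]
  rw [sum_prod_noiseProd_filter a fun ω => N <
    ∑ j : Fin L, cyclicAbs (noiseAt ω (n / 2 ^ (j : ℕ) * 2 ^ (j : ℕ)) (i, j))]
  simp only [hsum]
  refine le_trans ?_ ((sum_noiseProd_filter_le (M := M) (N := N) ha (J.image f)).trans
    (mul_le_mul_of_nonneg_right (pow_le_pow_right₀ (by norm_num) hJ) (Real.exp_pos _).le))
  refine Finset.sum_le_sum_of_subset_of_nonneg (fun x hx => ?_) fun x _ _ => noiseProd_nonneg _ _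
  rw [Finset.mem_filter] at hx ⊢
  exact ⟨hx.1, hx.2.le⟩

end NoiseTail

section Accuracy

variable {U : Type*} {R T L M : ℕ} [NeZero M]

/-- Bad seeds and bad noise each cost `ξ / 2`, and `(1 - ξ / 2) ^ 2 ≥ 1 - ξ`. -/
theorem one_sub_le_outcomeProb {C : ℕ} (hR : 0 < R) (a : ℝ) (lev : Fin R → U → Fin (L + 1))
    (est : (Fin (L + 1) → ZMod M) → ℝ) (S : Stream U T) (O : Set (Fin T → ℝ)) {ξ : ℝ}
    (hξ : ξ ≤ 1) (bad : Fin R → Prop)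
    (hbad : (open Classical in ((univ.filter bad).card : ℝ)) ≤ ξ / 2 * R)
    (hgood : ∀ r, ¬bad r → 1 - ξ / 2 ≤ noiseProb a (outcome C lev est r S) O) :
    1 - ξ ≤ outcomeProb C a lev est S O := by
  classical
  have hR' : (0 : ℝ) < R := by exact_mod_cast hR
  have h1 : ∑ r : Fin R, (R : ℝ)⁻¹ * ((1 - ξ / 2) * (1 - if bad r then 1 else 0)) ≤
      outcomeProb C a lev est S O := by
    refine Finset.sum_le_sum fun r _ => mul_le_mul_of_nonneg_left ?_ (by positivity)
    split_ifs with h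
    · simpa using noiseProb_nonneg _ _ _
    · simpa using hgood r h
  refine le_trans ?_ h1
  rw [← Finset.mul_sum, ← Finset.mul_sum, Finset.sum_sub_distrib, Finset.sum_boole]
  simp only [Finset.sum_const, Finset.card_univ, Fintype.card_fin, nsmul_eq_mul, mul_one]
  have h2 : (R : ℝ)⁻¹ * ((univ.filter bad).card : ℝ) ≤ ξ / 2 := by
    rw [inv_mul_le_iff₀ hR', mul_comm]
    convert hbad
  rw [mul_left_comm, mul_sub, inv_mul_cancel₀ hR'.ne']
  nlinarith [mul_le_mul_of_nonneg_left h2 (by linarith : 0 ≤ 1 - ξ / 2), sq_nonneg ξ]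

variable [Fintype U]

/-- If the seed samples well, then the estimates are accurate up to a small probability. -/
theorem one_sub_le_noiseProb {C : ℕ} (lev : Fin R → U → Fin (L + 1)) (r : Fin R) (S : Stream U T)
    {a e θ N : ℝ} (ha : 0 ≤ a) (he : 0 < e) (he1 : e ≤ 1 / 16) (hθ : 1 ≤ θ) (hN : 0 ≤ N)
    (hCθ : 16 * θ ≤ C) (hCN : 16 * N ≤ e * C) (hM : 2 * (C + N) < M) (hT1 : 1 ≤ T)
    (hT : T < 2 ^ L)
    (hr : ∀ (t : Fin T) i, ¬SampleDeviates e θ (seen S (t + 1)) i (lev r)) :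
    1 - T * (L + 1) * (3 ^ L * Real.exp (-(a / 2 * N))) ≤
      noiseProb a (outcome C lev (fun x : Fin (L + 1) → ZMod M =>
        estimate C fun i => (x i).valMinAbs) r S)
        {y | ∀ t, |y t - distinctCount S t| ≤ 2 * e * distinctCount S t + N} := by
  classical
  set O : Set (Fin T → ℝ) :=
    {y | ∀ t, |y t - distinctCount S t| ≤ 2 * e * distinctCount S t + N} with hO
  set bad : Fin T × Fin (L + 1) → (Fin T → Fin (L + 1) × Fin L → ZMod M) → Prop := fun p ω =>
    N < ∑ j : Fin L, cyclicAbs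
      (noiseAt ω (((p.1 : ℕ) + 1) / 2 ^ (j : ℕ) * 2 ^ (j : ℕ)) (p.2, j)) with hbad
  have hw (ω : Fin T → Fin (L + 1) × Fin L → ZMod M) : 0 ≤ ∏ t, noiseProd a (ω t) :=
    Finset.prod_nonneg fun _ _ => noiseProd_nonneg _ _
  have h1 := sum_filter_exists_le (fun ω : Fin T → Fin (L + 1) × Fin L → ZMod M =>
    ∏ t, noiseProd a (ω t)) bad hw (fun p => noiseAt_tail ha p.2 (p.1 + 1) p.1.2 hT1)
  rw [Fintype.card_prod, Fintype.card_fin, Fintype.card_fin] at h1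
  push_cast at h1
  have hgood (ω : Fin T → Fin (L + 1) × Fin L → ZMod M) (hω : ¬∃ p, bad p ω) :
      outcome C lev (fun x : Fin (L + 1) → ZMod M =>
        estimate C fun i => (x i).valMinAbs) r S ω ∈ O := by
    push Not at hω
    intro t
    rw [outcome_apply, distinctCount_eq_card_seen]
    refine abs_estimate_sub_le _ (fun i => (sampledSet (lev r) (seen S (t + 1)) i).card)
      he he1 hθ hN hCθ hCN (by simp) ((card_seen_le _ _).trans hT.le)
      (fun i => not_lt.1 (hr t i)) fun i => ?_
    exact abs_valMinAbs_add_sum_sub_le univ _ (min_le_left _ _) hM (not_lt.1 (hω (t, i)))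
  have h2 : ∑ ω : Fin T → Fin (L + 1) × Fin L → ZMod M, ∏ t, noiseProd a (ω t) ≤
      noiseProb a (outcome C lev (fun x : Fin (L + 1) → ZMod M =>
        estimate C fun i => (x i).valMinAbs) r S) O +
      ∑ ω with ∃ p, bad p ω, ∏ t, noiseProd a (ω t) := by
    rw [noiseProb, Finset.sum_filter, ← Finset.sum_add_distrib]
    refine Finset.sum_le_sum fun ω _ => ?_
    split_ifs with h
    · have := mul_nonneg (hw ω) (Set.indicator_nonneg (s := O) (f := 1)
        (fun _ _ => zero_le_one (α := ℝ)) (outcome C lev (fun x : Fin (L + 1) → ZMod M =>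
        estimate C fun i => (x i).valMinAbs) r S ω))
      linarith
    · rw [Set.indicator_of_mem (hgood ω h)]
      simp
  rw [sum_prod_noiseProd] at h2
  have h3 : ∑ ω with ∃ p, bad p ω, ∏ t, noiseProd a (ω t) ≤
      T * (L + 1) * (3 ^ L * Real.exp (-(a / 2 * N))) := by convert h1
  linarith

end Accuracy

/-! ### Numerical choice of parameters -/

section Parameters

variable {T : ℕ} {ξ : ℝ}

/-- `2 ^ (Nat.log 2 T + 1) ≤ 2 * T ≤ T / ξ`, the last step by `ξ < 1 / 2`. -/
theorem log_two_mul_le (hT : 1 ≤ T) (hξ : 0 < ξ) (hξ1 : ξ < 1 / 2) :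
    (Nat.log 2 T + 1 : ℝ) * Real.log 2 ≤ Real.log (T / ξ) := by
  have hT0 : (1 : ℝ) ≤ T := by exact_mod_cast hT
  have h1 : ((2 : ℝ) ^ (Nat.log 2 T + 1)) ≤ T / ξ := by
    have : ((2 : ℝ) ^ Nat.log 2 T) ≤ T := by
      exact_mod_cast Nat.pow_log_le_self 2 (by omega)
    rw [le_div_iff₀ hξ, pow_succ]
    nlinarith [pow_pos (zero_lt_two (α := ℝ)) (Nat.log 2 T)]
  have h2 := Real.log_le_log (by positivity) h1
  rw [Real.log_pow] at h2
  exact_mod_cast h2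

theorem log_two_le (hT : 1 ≤ T) (hξ : 0 < ξ) (hξ1 : ξ < 1 / 2) :
    Real.log 2 ≤ Real.log (T / ξ) := by
  have := log_two_mul_le hT hξ hξ1
  have h2 : 0 < Real.log 2 := Real.log_pos (by norm_num)
  nlinarith [(Nat.log 2 T).cast_nonneg (α := ℝ)]

theorem mul_exp_neg_log (hT : 1 ≤ T) (hξ : 0 < ξ) : T * Real.exp (-Real.log (T / ξ)) = ξ := by
  have hT0 : (0 : ℝ) < T := by exact_mod_cast hT
  rw [Real.exp_neg, Real.exp_log (by positivity)]
  field_simp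

theorem two_pow_le_exp_log (hT : 1 ≤ T) (hξ : 0 < ξ) (hξ1 : ξ < 1 / 2) :
    (2 : ℝ) ^ (Nat.log 2 T + 1) ≤ Real.exp (Real.log (T / ξ)) := by
  rw [← Real.log_le_log_iff (by positivity) (Real.exp_pos _), Real.log_pow, Real.log_exp]
  exact_mod_cast log_two_mul_le hT hξ hξ1

theorem levels_le_exp_log (hT : 1 ≤ T) (hξ : 0 < ξ) (hξ1 : ξ < 1 / 2) :
    (((Nat.log 2 T + 1 : ℕ) : ℝ) + 1) ≤ Real.exp (Real.log (T / ξ)) := by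
  refine le_trans ?_ (two_pow_le_exp_log hT hξ hξ1)
  exact_mod_cast Nat.succ_le_of_lt (Nat.lt_two_pow_self (n := Nat.log 2 T + 1))

theorem exp_neg_log_le_half (hT : 1 ≤ T) (hξ : 0 < ξ) (hξ1 : ξ < 1 / 2) :
    Real.exp (-Real.log (T / ξ)) ≤ 1 / 2 := by
  have := Real.exp_le_exp.2 (neg_le_neg (log_two_le hT hξ hξ1))
  rwa [Real.exp_neg (Real.log 2), Real.exp_log (by norm_num), ← one_div] at this

/-- Write `l = log (T / ξ)` and `L` for the number of tree levels. As `L ≤ 3 * l / 2`, the constant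
`120` makes the exponential at most `exp (-5 * l)`, which absorbs `L + 1 ≤ exp l` and `3 ^ L ≤ exp
(2 * l)`. What remains is `T * exp (-2 * l) ≤ ξ / 2`. -/
theorem noise_failure_le {ε : ℝ} (hε : 0 < ε) (hT : 1 ≤ T) (hξ : 0 < ξ) (hξ1 : ξ < 1 / 2) :
    (T : ℝ) * ((Nat.log 2 T + 1 : ℕ) + 1) * (3 ^ (Nat.log 2 T + 1) *
      Real.exp (-(ε / (8 * (Nat.log 2 T + 1 : ℕ)) / 2 * (120 * Real.log (T / ξ) ^ 2 / ε)))) ≤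
      ξ / 2 := by
  have h0 := log_two_mul_le hT hξ hξ1
  have h1 := levels_le_exp_log hT hξ hξ1
  have h2 := two_pow_le_exp_log hT hξ hξ1
  have h3 := exp_neg_log_le_half hT hξ hξ1
  have h4 := mul_exp_neg_log hT hξ
  have hlog := Real.log_two_gt_d9
  have hl2 := log_two_le hT hξ hξ1
  rw [← Nat.cast_succ] at h0
  set l := Real.log (T / ξ) with hl
  have hLpos : 0 < Nat.log 2 T + 1 := Nat.succ_pos _
  have h0' : ((Nat.log 2 T + 1 : ℕ) : ℝ) * Real.log 2 ≤ l := h0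
  generalize Nat.log 2 T + 1 = L at h0' h1 h2 hLpos ⊢
  have hLpos' : (0 : ℝ) < L := by exact_mod_cast hLpos
  have hl0 : 0 < l := by linarith
  have h5 : (3 : ℝ) ^ L ≤ Real.exp l * Real.exp l := by
    calc (3 : ℝ) ^ L ≤ 4 ^ L := by gcongr; norm_num
      _ = 2 ^ L * 2 ^ L := by rw [← mul_pow]; norm_num
      _ ≤ _ := by gcongr
  have h6 : Real.exp (-(ε / (8 * (L : ℝ)) / 2 * (120 * l ^ 2 / ε))) ≤ Real.exp (-(5 * l)) := by
    refine Real.exp_le_exp.2 (neg_le_neg ?_)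
    have : ε / (8 * (L : ℝ)) / 2 * (120 * l ^ 2 / ε) = 15 / 2 * l ^ 2 / L := by
      field_simp
      ring
    rw [this, le_div_iff₀ hLpos']
    have : (L : ℝ) * (2 / 3) ≤ l := by nlinarith
    nlinarith
  calc _ ≤ (T : ℝ) * Real.exp l * (Real.exp l * Real.exp l * Real.exp (-(5 * l))) := by
        gcongr
    _ = (T * Real.exp (-l)) * Real.exp (-l) := by
        simp only [mul_assoc, ← Real.exp_add]
        congr 2
        ring
    _ ≤ _ := by rw [h4]; nlinarith

/-- The constant `24` gives `exp (-6 * l)` with `l = log (T / ξ)`. One factor `exp (-l)` pays for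
the levels, one turns `T` into `ξ`, and the other four give `1 / 16`. -/
theorem sampling_failure_le {e : ℝ} (he : 0 < e) (hT : 1 ≤ T) (hξ : 0 < ξ) (hξ1 : ξ < 1 / 2) :
    (T : ℝ) * ((Nat.log 2 T + 1 : ℕ) + 1) *
      (2 * Real.exp (-(e ^ 2 * (24 * Real.log (T / ξ) / e ^ 2) / 4))) ≤ ξ / 8 := by
  have h1 := levels_le_exp_log hT hξ hξ1
  have h3 := exp_neg_log_le_half hT hξ hξ1
  have h4 := mul_exp_neg_log hT hξ
  set l := Real.log (T / ξ) with hl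
  have h5 : Real.exp (-(e ^ 2 * (24 * l / e ^ 2) / 4)) = Real.exp (-l) ^ 6 := by
    rw [← Real.exp_nat_mul]
    congr 1
    field_simp
    push_cast
    ring
  have h6 : Real.exp (-l) ^ 4 ≤ (1 / 2) ^ 4 := pow_le_pow_left₀ (Real.exp_pos _).le h3 4
  rw [h5]
  calc _ ≤ (T : ℝ) * Real.exp l * (2 * Real.exp (-l) ^ 6) := by gcongr
    _ = (T * Real.exp (-l)) * (2 * (Real.exp l * Real.exp (-l)) * Real.exp (-l) ^ 4) := by ring
    _ = ξ * (2 * Real.exp (-l) ^ 4) := by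
        rw [h4, ← Real.exp_add, add_neg_cancel, Real.exp_zero, mul_one]
    _ ≤ _ := by nlinarith

/-- A number of words that suffices to store a hash seed. -/
theorem exists_seed_words (U : Type*) [Fintype U] (hT : 1 ≤ T) (hξ : 0 < ξ) (hξ1 : ξ < 1 / 2) :
    ∃ w : ℕ, (w : ℝ) ≤ 9 * Real.log (T / ξ) ∧
      (Fintype.card (Stream U T) : ℝ) <
        Real.exp (ξ * (2 ^ (wordSize U T * w) : ℕ) / 4) := by
  have hb : Fintype.card U + T + 1 ≤ 2 ^ wordSize U T := Nat.le_pow_clog (by norm_num) _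
  have hb1 : 1 ≤ wordSize U T := Nat.clog_pos (by norm_num) (by omega)
  have hl2 := log_two_le hT hξ hξ1
  have hlog := Real.log_two_gt_d9
  set b := wordSize U T with hbdef
  set v := ⌈Real.log (4 / ξ) / Real.log 2⌉₊ with hv
  have hlog2 : 0 < Real.log 2 := by linarith
  have hξ4 : Real.log (4 / ξ) ≤ 3 * Real.log (T / ξ) := by
    have hT0 : (1 : ℝ) ≤ T := by exact_mod_cast hT
    have h1 : Real.log (4 / ξ) = 2 * Real.log 2 + Real.log (1 / ξ) := by
      rw [show 4 / ξ = 2 ^ 2 * (1 / ξ) by ring, Real.log_mul (by norm_num) (by positivity),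
        Real.log_pow]
      norm_num
    have h2 : Real.log (1 / ξ) ≤ Real.log (T / ξ) :=
      Real.log_le_log (by positivity) (by gcongr)
    linarith
  have hξ0 : 0 ≤ Real.log (4 / ξ) := Real.log_nonneg (by rw [le_div_iff₀ hξ]; linarith)
  -- `v` words outweigh `4 / ξ`; two more outweigh `b * T`, which bounds the binary logarithm of the
  -- number of streams.
  refine ⟨v + 2, ?_, ?_⟩
  · have h1 := (Nat.ceil_lt_add_one (div_nonneg hξ0 hlog2.le)).le
    have h2 : Real.log (4 / ξ) / Real.log 2 ≤ 4.4 * Real.log (T / ξ) := by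
      rw [div_le_iff₀ hlog2]
      nlinarith
    push_cast
    linarith
  · have hv4 : 4 / ξ ≤ (2 : ℝ) ^ v := by
      rw [← Real.log_le_log_iff (by positivity) (by positivity), Real.log_pow]
      have := Nat.le_ceil (Real.log (4 / ξ) / Real.log 2)
      rwa [div_le_iff₀ hlog2] at this
    have hbT : ((b * T : ℕ) : ℝ) ≤ ξ * (2 ^ (b * (v + 2)) : ℕ) / 4 := by
      have h1 : b * T ≤ 2 ^ b * 2 ^ b :=
        Nat.mul_le_mul Nat.lt_two_pow_self.le (by omega)
      have h2 : (2 : ℝ) ^ v ≤ 2 ^ (b * v) :=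
        pow_le_pow_right₀ (by norm_num) (Nat.le_mul_of_pos_left v hb1)
      have h3 : (1 : ℝ) ≤ ξ * 2 ^ (b * v) / 4 := by
        have := hv4.trans h2
        rw [div_le_iff₀ hξ] at this
        linarith
      calc ((b * T : ℕ) : ℝ) ≤ ((2 ^ b * 2 ^ b : ℕ) : ℝ) := by exact_mod_cast h1
        _ = 2 ^ b * 2 ^ b * 1 := by push_cast; ring
        _ ≤ 2 ^ b * 2 ^ b * (ξ * 2 ^ (b * v) / 4) := by gcongr
        _ = _ := by push_cast; ring
    refine lt_of_lt_of_le ?_ (Real.exp_le_exp.2 hbT)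
    have h1 : Fintype.card (Stream U T) ≤ 2 ^ (b * T) := by
      simp only [Stream, Fintype.card_fun, Fintype.card_option, Fintype.card_fin, pow_mul]
      exact Nat.pow_le_pow_left (by omega) T
    have h2 : (2 : ℝ) < Real.exp 1 := by linarith [Real.exp_one_gt_d9]
    calc (Fintype.card (Stream U T) : ℝ) ≤ 2 ^ (b * T) := by exact_mod_cast h1
      _ < Real.exp 1 ^ (b * T) :=
          pow_lt_pow_left₀ h2 (by norm_num) (Nat.mul_pos hb1 hT).ne'
      _ = _ := by rw [← Real.exp_nat_mul, mul_one]

/-- The noise cells dominate: `M` is of order `X ^ 2` and there are about `L ^ 2` of them, whence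
the exponent `4`. -/
theorem words_le {X : ℝ} {w L C M : ℕ} (hX : 1 ≤ X) (hw : w ≤ 5 * X) (hC : C ≤ 45000 * X ^ 2)
    (hM : M ≤ 91000 * X ^ 2) (hL : L ≤ X) :
    ((w + 1 + C * (L + 1) + M * ((L + 1) * L) : ℕ) : ℝ) ≤ 300000 * X ^ 4 := by
  have hX0 : 0 ≤ X := by linarith
  have t1 : (w : ℝ) + 1 ≤ 6 * X ^ 4 := by
    have h1 : X ≤ X ^ 4 := le_self_pow₀ hX (by norm_num)
    linarith
  have t2 : (C : ℝ) * (L + 1) ≤ 90000 * X ^ 4 := by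
    calc (C : ℝ) * (L + 1) ≤ (45000 * X ^ 2) * (X + X) := by gcongr
      _ = 90000 * X ^ 3 := by ring
      _ ≤ 90000 * X ^ 4 :=
          mul_le_mul_of_nonneg_left (pow_le_pow_right₀ hX (by norm_num)) (by norm_num)
  have t3 : (M : ℝ) * ((L + 1) * L) ≤ 182000 * X ^ 4 := by
    calc (M : ℝ) * ((L + 1) * L) ≤ (91000 * X ^ 2) * ((X + X) * X) := by gcongr
      _ = 182000 * X ^ 4 := by ring
  have t4 : 0 ≤ X ^ 4 := by positivity
  push_cast
  linarith

theorem space_le {ε η : ℝ} {w L C M : ℕ} (hε : 0 < ε) (hη : 0 < η) (hη1 : η < 1 / 2)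
    (hl : Real.log 2 ≤ Real.log (T / ξ)) (hL : L * Real.log 2 ≤ Real.log (T / ξ))
    (hw : w ≤ 9 * Real.log (T / ξ))
    (hC : C = ⌈16 * (24 * Real.log (T / ξ) / (η / 8) ^ 2 +
      120 * Real.log (T / ξ) ^ 2 / ε / (η / 8))⌉₊)
    (hM : M = 2 * (C + ⌈120 * Real.log (T / ξ) ^ 2 / ε⌉₊) + 3) :
    ((w + 1 + C * (L + 1) + M * ((L + 1) * L) : ℕ) : ℝ) ≤
      300000 * (Real.log (T / ξ) / (η * min ε 1)) ^ 4 := by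
  set l := Real.log (T / ξ) with hldef
  have hlog := Real.log_two_gt_d9
  have hl0 : 0 < l := by linarith
  set m := min ε 1 with hm
  have hm0 : 0 < m := lt_min hε one_pos
  have hmε : m ≤ ε := min_le_left _ _
  have hm1 : m ≤ 1 := min_le_right _ _
  set X := l / (η * m) with hX
  have hηm : η * m ≤ 1 / 2 := by nlinarith
  have hlX : 2 * l ≤ X := by
    rw [hX, le_div_iff₀ (by positivity)]
    nlinarith
  have hX1 : 1 ≤ X := by linarith
  have hX0 : 0 < X := by linarith
  have hlX' : l = X * (η * m) := by rw [hX]; field_simp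
  have hA : l / η ^ 2 ≤ 1.5 * X ^ 2 := by
    rw [div_le_iff₀ (by positivity)]
    have h1 : l ≤ 1.5 * l ^ 2 := by nlinarith
    have h2 : l ^ 2 ≤ X ^ 2 * η ^ 2 := by
      have : l ≤ X * η := by
        rw [hlX']
        exact mul_le_mul_of_nonneg_left (by nlinarith) hX0.le
      calc l ^ 2 ≤ (X * η) ^ 2 := pow_le_pow_left₀ hl0.le this 2
        _ = _ := by ring
    nlinarith
  have hB : l ^ 2 / ε / η ≤ X ^ 2 / 2 := by
    rw [div_div, div_le_iff₀ (by positivity)]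
    have : l ^ 2 = X ^ 2 * (η * m) ^ 2 := by rw [hlX']; ring
    rw [this]
    have h1 : (η * m) ^ 2 ≤ 1 / 2 * (ε * η) := by
      calc (η * m) ^ 2 = (η * m) * (m * η) := by ring
        _ ≤ (1 / 2) * (ε * η) := by gcongr
    calc X ^ 2 * (η * m) ^ 2 ≤ X ^ 2 * (1 / 2 * (ε * η)) := by gcongr
      _ = _ := by ring
  have hB' : l ^ 2 / ε ≤ X ^ 2 / 4 := by
    rw [div_le_iff₀ hη] at hB
    nlinarith [sq_nonneg X]
  have hX2 : 1 ≤ X ^ 2 := one_le_pow₀ hX1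
  have hC' : (C : ℝ) ≤ 45000 * X ^ 2 := by
    have h1 := (Nat.ceil_lt_add_one (a := 16 * (24 * l / (η / 8) ^ 2 + 120 * l ^ 2 / ε / (η / 8)))
      (by positivity)).le
    rw [← hC] at h1
    have h2 : 16 * (24 * l / (η / 8) ^ 2 + 120 * l ^ 2 / ε / (η / 8)) =
        24576 * (l / η ^ 2) + 15360 * (l ^ 2 / ε / η) := by
      field_simp
      ring
    linarith
  have hN' : ((⌈120 * l ^ 2 / ε⌉₊ : ℕ) : ℝ) ≤ 31 * X ^ 2 := by
    have h1 := (Nat.ceil_lt_add_one (a := 120 * l ^ 2 / ε) (by positivity)).le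
    have h2 : 120 * l ^ 2 / ε = 120 * (l ^ 2 / ε) := mul_div_assoc _ _ _
    linarith
  have hM' : (M : ℝ) ≤ 91000 * X ^ 2 := by
    rw [hM]
    push_cast
    linarith
  have hL' : (L : ℝ) ≤ X := by nlinarith [(L.cast_nonneg : (0 : ℝ) ≤ L)]
  exact words_le hX1 (by linarith) hC' hM' hL'

end Parameters

/-! ### Assembly -/

theorem isApprox_of_abs_sub_le {η N γ n y : ℝ} (hη : 0 < η) (hη1 : η < 1 / 2) (hn : 0 ≤ n)
    (hγ : N ≤ γ) (h : |y - n| ≤ 2 * (η / 8) * n + N) : IsApprox (1 + 1 * η) γ n y := by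
  have h := abs_le.1 h
  have h0 := mul_nonneg hη.le hn
  constructor
  · have h1 : 1 / (1 + 1 * η) ≤ 1 - 2 * (η / 8) := by
      rw [div_le_iff₀ (by positivity)]
      nlinarith
    have := mul_le_mul_of_nonneg_right h1 hn
    linarith
  · linarith

/-- Some prefix of `S` is not sampled well at some level. -/
def SamplesBadly {U : Type*} [Fintype U] {T L : ℕ} (e θ : ℝ) (S : Stream U T)
    (h : U → Fin (L + 1)) : Prop :=
  ∃ p : Fin T × Fin (L + 1), SampleDeviates e θ (seen S (p.1 + 1)) p.2 h

/-- A table of level functions that samples all prefixes of every stream well. -/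
theorem exists_levels (U : Type*) [Fintype U] {T L R : ℕ} {e θ ξ : ℝ} (he : 0 < e) (he1 : e ≤ 1)
    (hsample : T * ((L : ℝ) + 1) * (2 * Real.exp (-(e ^ 2 * θ / 4))) ≤ ξ / 8)
    (hR : (Fintype.card (Stream U T) : ℝ) < Real.exp (ξ * R / 4)) :
    ∃ lev : Fin R → U → Fin (L + 1), ∀ S : Stream U T,
      (open Classical in ((Finset.univ.filter fun r => SamplesBadly e θ S (lev r)).card : ℝ)) ≤
        ξ / 2 * R := by
  classical
  refine exists_table levelLaw levelLaw_nonneg sum_levelLaw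
    (fun (S : Stream U T) h => SamplesBadly e θ S h) (fun S => ?_) R hR
  have h := sum_filter_exists_le (levelLaw (U := U) (L := L))
    (fun (p : Fin T × Fin (L + 1)) h => SampleDeviates e θ (seen S (p.1 + 1)) p.2 h)
    levelLaw_nonneg (fun p => sum_levelLaw_deviates_le he he1 _ _)
  rw [Fintype.card_prod, Fintype.card_fin, Fintype.card_fin] at h
  push_cast at h
  refine le_trans (le_of_eq ?_) (h.trans hsample)
  congr!

end

end ContinualRelease

theorem mainTheorem3 :
    ∃ (c₁ c₂ c₃ : ℝ) (k : ℕ), 0 < c₁ ∧ 0 < c₂ ∧ 0 < c₃ ∧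
      ∀ (U : Type*) [Fintype U] (T : ℕ) (ε η ξ : ℝ),
        1 ≤ T → 0 < ε → 0 < η → η < 1 / 2 → 0 < ξ → ξ < 1 / 2 →
        ∃ (W : ℕ) (A : ContinualRelease.StreamingAlgorithm U (ContinualRelease.wordSize U T) W),
          (W : ℝ) ≤ c₃ * (Real.log (T / ξ) / (η * min ε 1)) ^ k ∧
          A.IsDP T ε ∧
          ∀ S : ContinualRelease.Stream U T,
            ENNReal.ofReal (1 - ξ) ≤
              A.outputProb S {y | ∀ t : Fin T,
                ContinualRelease.IsApprox (1 + c₁ * η) (c₂ * (Real.log (T / ξ) ^ 2 / (η ^ 2 * ε)))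
                  (ContinualRelease.distinctCount S t) (y t)} := by
  -- The estimator's relative error is `2 * (η / 8) ≤ η`, so `c₁ = 1`; `120` is the constant of the
  -- noise bound `N`.
  refine ⟨1, 120, 300000, 4, by norm_num, by norm_num, by norm_num, ?_⟩
  intro U _ T ε η ξ hT hε hη hη1 hξ hξ1
  classical
  obtain ⟨w, hw, hR⟩ := ContinualRelease.exists_seed_words U hT hξ hξ1
  have hl := ContinualRelease.log_two_le hT hξ hξ1
  have hL := ContinualRelease.log_two_mul_le hT hξ hξ1
  have hnoise := ContinualRelease.noise_failure_le hε hT hξ hξ1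
  have hsample := ContinualRelease.sampling_failure_le (e := η / 8) (by positivity) hT hξ hξ1
  have hTL : T < 2 ^ (Nat.log 2 T + 1) := Nat.lt_pow_succ_log_self (by norm_num) T
  rw [← Nat.cast_succ, Nat.succ_eq_add_one] at hL
  have hlog := Real.log_two_gt_d9
  generalize Nat.log 2 T + 1 = L at *
  set R := 2 ^ (ContinualRelease.wordSize U T * w) with hRdef
  have hR0 : 0 < R := by positivity
  set θ := 24 * Real.log (T / ξ) / (η / 8) ^ 2 with hθdef
  set N := 120 * Real.log (T / ξ) ^ 2 / ε with hNdef
  -- This secures both capacity conditions of the estimator, `16 * θ ≤ C` and `16 * N ≤ e * C` with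
  -- `e = η / 8`.
  set C := ⌈16 * (θ + N / (η / 8))⌉₊ with hC
  set M := 2 * (C + ⌈N⌉₊) + 3 with hM
  have hM0 : NeZero M := ⟨by omega⟩
  have hN0 : 0 ≤ N := by positivity
  have hθ : 1 ≤ θ := by
    rw [hθdef, le_div_iff₀ (by positivity)]
    nlinarith
  have hCle : 16 * (θ + N / (η / 8)) ≤ C := Nat.le_ceil _
  have hNe : 0 ≤ N / (η / 8) := by positivity
  have hMN : 2 * (C + N) < M := by
    have := Nat.le_ceil N
    rw [hM]
    push_cast
    linarith
  have hCN : 16 * N ≤ η / 8 * C := by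
    have h1 : 16 * (N / (η / 8)) ≤ C := by linarith
    have h2 : N / (η / 8) * (η / 8) = N := div_mul_cancel₀ _ (by positivity)
    nlinarith
  obtain ⟨lev, hlev⟩ := ContinualRelease.exists_levels U (e := η / 8) (θ := θ) (by positivity)
    (by linarith) hsample hR
  obtain ⟨A, hDP, hA⟩ := ContinualRelease.exists_streamingAlgorithm (U := U) C w
    -- This rate cancels the total translation `8 * L`, leaving privacy loss `ε`.
    (a := ε / (8 * L)) (by positivity) hR0 le_rfl hT hTL lev
    (fun x : Fin (L + 1) → ZMod M => ContinualRelease.estimate C fun i => (x i).valMinAbs)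
  refine ⟨_, A, ContinualRelease.space_le hε hη hη1 hl hL hw hC hM, ?_, fun S => ?_⟩
  · have hL0 : (L : ℝ) ≠ 0 := by
      rintro h
      have : L = 0 := by exact_mod_cast h
      subst this
      omega
    have : ε / (8 * L) * (8 * L) = ε := div_mul_cancel₀ _ (by positivity)
    rwa [this] at hDP
  · refine le_trans (b := A.outputProb S {y | ∀ t, |y t - ContinualRelease.distinctCount S t| ≤
      2 * (η / 8) * ContinualRelease.distinctCount S t + N}) ?_ ?_
    · rw [hA]
      refine ENNReal.ofReal_le_ofReal (ContinualRelease.one_sub_le_outcomeProb hR0 _ lev _ S _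
        (by linarith) _ (hlev S) fun r hr => ?_)
      refine le_trans ?_ (ContinualRelease.one_sub_le_noiseProb lev r S (θ := θ) (by positivity)
        (by positivity) (by linarith) hθ hN0 (by linarith) hCN hMN hT hTL
        fun t i h => hr ⟨(t, i), h⟩)
      linarith
    · refine MeasureTheory.measure_mono fun y hy t => ?_
      have hγ : N ≤ 120 * (Real.log (T / ξ) ^ 2 / (η ^ 2 * ε)) := by
        rw [hNdef, mul_div_assoc]
        refine mul_le_mul_of_nonneg_left
          (div_le_div_of_nonneg_left (by positivity) (by positivity) ?_) (by norm_num)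
        exact mul_le_of_le_one_left hε.le (pow_le_one₀ hη.le (by linarith))
      exact ContinualRelease.isApprox_of_abs_sub_le hη hη1 (Nat.cast_nonneg _) hγ (hy t)
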